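/- Let $m,n$ be positive integers and $N=m+n$. Let $\mathrm{Sp}(N)$ be the quaternionic unitary group in its standard complex representation, i.e. the group of all unitary $2N\times 2N$ complex matrices of the block form $$q=\begin{bmatrix} z & w\\ -\bar w & \bar z\end{bmatrix},\qquad z,w\in\mathbb C^{N\times N},$$ equipped with the left-invariant (in fact bi-invariant) Riemannian metric $g$ induced by the inner product $(Z,W)\mapsto \mathrm{Re}\,\mathrm{trace}(Z\bar W^t)$ on its Lie algebra $\mathfrak{sp}(N)\subset\mathbb C^{2N\times 2N}$. For smooth functions $\phi,\psi:\mathrm{Sp}(N)\to\mathbb C$, let $\tau(\phi)$ be the Laplace--Beltrami operator (tension field) and $\kappa(\phi,\psi)=g(\nabla\phi,\nabla\psi)$ the complex bilinear conformality operator of $(\mathrm{Sp}(N),g)$, so that in any smooth local coordinates $x_1,\dots,x_d$ on $\mathrm{Sp}(N)$ $$\tau(\phi)=\sum_{i,j=1}^d\frac1{\sqrt{|g|}}\frac{\partial}{\partial x_j}\Bigl(g^{ij}\sqrt{|g|}\,\frac{\partial\phi}{\partial x_i}\Bigr),\qquad \kappa(\phi,\psi)=\sum_{i,j=1}^d g^{ij}\,\frac{\partial\phi}{\partial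 x_i}\frac{\partial\psi}{\partial x_j},$$ where $|g|=\det(g_{ij})$. Put $I_{m,n}=\mathrm{diag}(I_m,-I_n)$, $\hat I_{m,n}=\mathrm{diag}(I_{m,n},I_{m,n})$, and for $1\le j,\alpha\le 2(m+n)$ let $$\hat\psi_{j\alpha}:\mathrm{Sp}(m+n)\to\mathbb C,\qquad \hat\psi_{j\alpha}(q)=\tfrac12\bigl(q\,\hat I_{m,n}\,\bar q^t+I_{2(m+n)}\bigr)_{j\alpha}.$$ Then for all $1\le j,k,\alpha\le 2(m+n)$ with $j\ne\alpha$ and $k\neq\alpha$ we have, on all of $\mathrm{Sp}(m+n)$, $$\tau(\hat\psi_{j\alpha})=-2(m+n)\,\hat\psi_{j\alpha}\qquad\text{and}\qquad \kappa(\hat\psi_{j\alpha},\hat\psi_{k\alpha})=-\,\hat\psi_{j\alpha}\,\hat\psi_{k\alpha}.$$ -/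

import Mathlib

open scoped ContDiff Matrix

noncomputable section

namespace QuaternionicUnitary

set_option linter.unusedSectionVars false
set_option linter.unusedSimpArgs false

variable {ι : Type*} [Fintype ι] [DecidableEq ι]

/-- The standard complex representation `z + j w ↦ [[z, w], [-w̄, z̄]]` of quaternionic
`N × N` matrices as complex `2N × 2N` matrices. -/
def quatMatrix (z w : Matrix ι ι ℂ) : Matrix (ι ⊕ ι) (ι ⊕ ι) ℂ :=
  Matrix.fromBlocks z w (-(w.map star)) (z.map star)

lemma map_star_mul (a b : Matrix ι ι ℂ) : (a * b).map star = a.map star * b.map star := by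
  ext i j
  simp [Matrix.mul_apply]

lemma quatMatrix_mul (z w z' w' : Matrix ι ι ℂ) :
    quatMatrix z w * quatMatrix z' w' =
      quatMatrix (z * z' - w * w'.map star) (z * w' + w * z'.map star) := by
  have hs : ∀ a : Matrix ι ι ℂ, (a.map star).map star = a := fun a => by ext; simp
  have ha : ∀ a b : Matrix ι ι ℂ, (a + b).map star = a.map star + b.map star := fun a b => by
    ext; simp
  have hb : ∀ a b : Matrix ι ι ℂ, (a - b).map star = a.map star - b.map star := fun a b => by
    ext; simp
  simp only [quatMatrix, Matrix.fromBlocks_multiply, map_star_mul, hs, ha, hb]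
  congr 1
  · simp [sub_eq_add_neg]
  · simp [sub_eq_neg_add]
  · simp [sub_eq_add_neg, add_comm]

lemma quatMatrix_one : (1 : Matrix (ι ⊕ ι) (ι ⊕ ι) ℂ) = quatMatrix 1 0 := by
  have h1 : (1 : Matrix ι ι ℂ).map star = 1 := by
    ext i j; simp [Matrix.one_apply, apply_ite]
  have h0 : (0 : Matrix ι ι ℂ).map star = 0 := by ext; simp
  simp [quatMatrix, h1, h0]

lemma quatMatrix_conjTranspose (z w : Matrix ι ι ℂ) :
    (quatMatrix z w)ᴴ = quatMatrix zᴴ (-wᵀ) := by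
  simp only [quatMatrix, Matrix.fromBlocks_conjTranspose]
  congr 1 <;> ext <;> simp

/-- The quaternionic unitary group `Sp(N)`, `N = card ι`: the intersection of the unitary group
`U(2N)` with the standard complex representation of the quaternionic matrices. -/
def Sp (ι : Type*) [Fintype ι] [DecidableEq ι] :
    Subgroup (Matrix.unitaryGroup (ι ⊕ ι) ℂ) where
  carrier := {q | ∃ z w : Matrix ι ι ℂ, (q : Matrix (ι ⊕ ι) (ι ⊕ ι) ℂ) = quatMatrix z w}
  mul_mem' := by
    rintro a b ⟨z, w, h⟩ ⟨z', w', h'⟩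
    exact ⟨_, _, by rw [Submonoid.coe_mul, h, h', quatMatrix_mul]⟩
  one_mem' := ⟨1, 0, by rw [← quatMatrix_one]; rfl⟩
  inv_mem' := by
    rintro a ⟨z, w, h⟩
    refine ⟨zᴴ, -wᵀ, ?_⟩
    rw [← quatMatrix_conjTranspose, ← h]
    rfl

/-- The complex `2N × 2N` matrix of an element of `Sp(N)`. -/
def toMatrix (q : Sp ι) : Matrix (ι ⊕ ι) (ι ⊕ ι) ℂ := ((q : Matrix.unitaryGroup (ι ⊕ ι) ℂ) : _)

/-- The Lie algebra `sp(N)` of `Sp(N)`. -/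
def spAlgebra (ι : Type*) [Fintype ι] [DecidableEq ι] :
    Submodule ℝ (Matrix (ι ⊕ ι) (ι ⊕ ι) ℂ) where
  carrier := {X | ∃ Z W : Matrix ι ι ℂ, X = quatMatrix Z W ∧ Zᴴ + Z = 0 ∧ Wᵀ - W = 0}
  add_mem' := by
    rintro _ _ ⟨Z, W, rfl, hZ, hW⟩ ⟨Z', W', rfl, hZ', hW'⟩
    refine ⟨Z + Z', W + W', ?_, ?_, ?_⟩
    · simp only [quatMatrix, Matrix.fromBlocks_add]
      congr 1 <;> ext <;> simp [add_comm]
    · rw [Matrix.conjTranspose_add, add_add_add_comm, hZ, hZ', add_zero]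
    · rw [Matrix.transpose_add, add_sub_add_comm, hW, hW', add_zero]
  zero_mem' := ⟨0, 0, by
    have h0 : (0 : Matrix ι ι ℂ).map star = 0 := by ext; simp
    simp [quatMatrix, h0], by simp, by simp⟩
  smul_mem' := by
    rintro c _ ⟨Z, W, rfl, hZ, hW⟩
    refine ⟨c • Z, c • W, ?_, ?_, ?_⟩
    · simp only [quatMatrix, Matrix.fromBlocks_smul]
      congr 1 <;> ext <;> simp
    · rw [Matrix.conjTranspose_smul, star_trivial, ← smul_add, hZ, smul_zero]
    · rw [Matrix.transpose_smul, ← smul_sub, hW, smul_zero]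

/-- The left-invariant Riemannian metric on `Sp(N)` that is induced by the inner product
`(Z, W) ↦ Re tr (Z W̄ᵗ)` on the Lie algebra; `A` and `B` are tangent vectors at `q`, seen as
matrices. It is bi-invariant, see `metric_biinvariant`. -/
def metric (q : Sp ι) (A B : Matrix (ι ⊕ ι) (ι ⊕ ι) ℂ) : ℝ :=
  (((toMatrix q⁻¹ * A) * (toMatrix q⁻¹ * B)ᴴ).trace).re

lemma toMatrix_mul (p q : Sp ι) : toMatrix (p * q) = toMatrix p * toMatrix q := rfl

lemma toMatrix_inv (q : Sp ι) : toMatrix q⁻¹ = (toMatrix q)ᴴ := rfl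

lemma toMatrix_mul_inv (q : Sp ι) : toMatrix q * toMatrix q⁻¹ = 1 := by
  rw [← toMatrix_mul, mul_inv_cancel]; rfl

lemma toMatrix_inv_mul (q : Sp ι) : toMatrix q⁻¹ * toMatrix q = 1 := by
  rw [← toMatrix_mul, inv_mul_cancel]; rfl

lemma metric_biinvariant (p q r : Sp ι) (A B : Matrix (ι ⊕ ι) (ι ⊕ ι) ℂ) :
    metric (p * q * r) (toMatrix p * A * toMatrix r) (toMatrix p * B * toMatrix r) =
      metric q A B := by
  have key : ∀ C : Matrix (ι ⊕ ι) (ι ⊕ ι) ℂ,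
      toMatrix (p * q * r)⁻¹ * (toMatrix p * C * toMatrix r) =
        toMatrix r⁻¹ * (toMatrix q⁻¹ * C) * toMatrix r := fun C => by
    rw [mul_inv_rev, mul_inv_rev, toMatrix_mul, toMatrix_mul]
    calc _ = toMatrix r⁻¹ * (toMatrix q⁻¹ * ((toMatrix p⁻¹ * toMatrix p) * C)) * toMatrix r := by
            simp only [Matrix.mul_assoc]
      _ = _ := by rw [toMatrix_inv_mul, Matrix.one_mul]
  unfold metric
  rw [key, key]
  set X := toMatrix q⁻¹ * A
  set Y := toMatrix q⁻¹ * B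
  have h : toMatrix r⁻¹ * X * toMatrix r * (toMatrix r⁻¹ * Y * toMatrix r)ᴴ =
      toMatrix r⁻¹ * (X * Yᴴ * toMatrix r) := by
    rw [Matrix.conjTranspose_mul, Matrix.conjTranspose_mul, ← toMatrix_inv r,
      toMatrix_inv r, Matrix.conjTranspose_conjTranspose, ← toMatrix_inv r]
    calc _ = toMatrix r⁻¹ * X * ((toMatrix r * toMatrix r⁻¹) * (Yᴴ * toMatrix r)) := by
            simp only [Matrix.mul_assoc]
      _ = _ := by rw [toMatrix_mul_inv, Matrix.one_mul]; simp only [Matrix.mul_assoc]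
  rw [h, Matrix.trace_mul_comm, Matrix.mul_assoc, toMatrix_mul_inv, Matrix.mul_one]

/-- The dimension of `Sp(N)`. -/
abbrev dimSp (ι : Type*) [Fintype ι] [DecidableEq ι] : ℕ := Module.finrank ℝ (spAlgebra ι)

/-- Topological charts of `Sp(N)`: homeomorphisms from an open subset of `Sp(N)` onto an open
subset of `ℝ^d`, where `d = dim Sp(N)`. -/
abbrev Chart (ι : Type*) [Fintype ι] [DecidableEq ι] :=
  OpenPartialHomeomorph (Sp ι) (Fin (dimSp ι) → ℝ)

/-- The inverse of a chart, as a map from `ℝ^d` to the complex `2N × 2N` matrices. -/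
def param (e : Chart ι) (x : Fin (dimSp ι) → ℝ) : (ι ⊕ ι) → (ι ⊕ ι) → ℂ :=
  fun a b => toMatrix (e.symm x) a b

/-- The smooth charts (local coordinates) of `Sp(N)` as an embedded submanifold of the space of
complex `2N × 2N` matrices: those whose inverse is a smooth immersion. -/
structure IsSmoothChart (e : Chart ι) : Prop where
  contDiffOn : ContDiffOn ℝ ∞ (param e) e.target
  injective_fderiv : ∀ x ∈ e.target, Function.Injective (fderiv ℝ (param e) x)

/-! Existence of smooth charts around every point, by the Cayley transform. -/

section Existence

lemma isQuat_iff (A : Matrix (ι ⊕ ι) (ι ⊕ ι) ℂ) :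
    (∃ z w, A = quatMatrix z w) ↔
      A * Matrix.fromBlocks 0 1 (-1) 0 = Matrix.fromBlocks 0 1 (-1) 0 * A.map star := by
  constructor
  · rintro ⟨z, w, rfl⟩
    simp only [quatMatrix, Matrix.fromBlocks_map, Matrix.fromBlocks_multiply]
    congr 1 <;> ext <;> simp
  · intro h
    rw [← Matrix.fromBlocks_toBlocks A] at h ⊢
    simp only [Matrix.fromBlocks_map, Matrix.fromBlocks_multiply] at h
    obtain ⟨h1, h2, h3, h4⟩ := Matrix.fromBlocks_inj.1 h
    refine ⟨A.toBlocks₁₁, A.toBlocks₁₂, ?_⟩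
    unfold quatMatrix
    congr 1
    · ext i j
      have := congrArg star (congrFun (congrFun h1 i) j)
      simp at this
      simp [← this]
    · ext i j
      have := congrArg star (congrFun (congrFun h2 i) j)
      simp at this
      simp [this]

lemma isQuat_inv {A : Matrix (ι ⊕ ι) (ι ⊕ ι) ℂ} (h : ∃ z w, A = quatMatrix z w) :
    ∃ z w, A⁻¹ = quatMatrix z w := by
  by_cases hA : IsUnit A.det
  · rw [isQuat_iff] at h ⊢
    set J : Matrix (ι ⊕ ι) (ι ⊕ ι) ℂ := Matrix.fromBlocks 0 1 (-1) 0
    have h1 : A.map star * A⁻¹.map star = 1 := by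
      rw [← map_star_mul, Matrix.mul_nonsing_inv _ hA]
      ext i j; simp [Matrix.one_apply, apply_ite]
    calc A⁻¹ * J = A⁻¹ * (J * (A.map star * A⁻¹.map star)) := by rw [h1, Matrix.mul_one]
      _ = A⁻¹ * (J * A.map star) * A⁻¹.map star := by simp only [Matrix.mul_assoc]
      _ = (A⁻¹ * A) * J * A⁻¹.map star := by rw [← h]; simp only [Matrix.mul_assoc]
      _ = _ := by rw [Matrix.nonsing_inv_mul _ hA, Matrix.one_mul]
  · rw [Matrix.nonsing_inv_apply_not_isUnit _ hA, isQuat_iff]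
    ext i j; simp [Matrix.mul_apply]

lemma isQuat_mul {A B : Matrix (ι ⊕ ι) (ι ⊕ ι) ℂ} (h : ∃ z w, A = quatMatrix z w)
    (h' : ∃ z w, B = quatMatrix z w) : ∃ z w, A * B = quatMatrix z w := by
  obtain ⟨z, w, rfl⟩ := h
  obtain ⟨z', w', rfl⟩ := h'
  exact ⟨_, _, quatMatrix_mul _ _ _ _⟩

lemma isQuat_add {A B : Matrix (ι ⊕ ι) (ι ⊕ ι) ℂ} (h : ∃ z w, A = quatMatrix z w)
    (h' : ∃ z w, B = quatMatrix z w) : ∃ z w, A + B = quatMatrix z w := by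
  rw [isQuat_iff] at *
  rw [Matrix.add_mul, h, h', ← Matrix.mul_add]
  congr 1
  ext a b
  simp

lemma isQuat_neg {A : Matrix (ι ⊕ ι) (ι ⊕ ι) ℂ} (h : ∃ z w, A = quatMatrix z w) :
    ∃ z w, -A = quatMatrix z w := by
  rw [isQuat_iff] at *
  rw [Matrix.neg_mul, h, ← Matrix.mul_neg]
  congr 1

lemma mem_spAlgebra_iff (X : Matrix (ι ⊕ ι) (ι ⊕ ι) ℂ) :
    X ∈ spAlgebra ι ↔ (∃ z w, X = quatMatrix z w) ∧ Xᴴ = -X := by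
  have hneg : ∀ Z W : Matrix ι ι ℂ, -quatMatrix Z W = quatMatrix (-Z) (-W) := fun Z W => by
    simp only [quatMatrix, Matrix.fromBlocks_neg]
    congr 1
  constructor
  · rintro ⟨Z, W, rfl, hZ, hW⟩
    refine ⟨⟨Z, W, rfl⟩, ?_⟩
    rw [quatMatrix_conjTranspose, hneg, eq_neg_of_add_eq_zero_left hZ, sub_eq_zero.1 hW]
  · rintro ⟨⟨Z, W, rfl⟩, h⟩
    rw [quatMatrix_conjTranspose, hneg] at h
    obtain ⟨h1, h2, -, -⟩ := Matrix.fromBlocks_inj.1 h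
    exact ⟨Z, W, rfl, by rw [h1]; simp, by rw [neg_inj.1 h2]; simp⟩

open scoped ComplexOrder in
lemma isUnit_one_sub {X : Matrix (ι ⊕ ι) (ι ⊕ ι) ℂ} (h : Xᴴ = -X) : IsUnit (1 - X).det := by
  have h1 : ((1 - X) * (1 + X)).PosDef := by
    have : (1 - X) * (1 + X) = 1 + X * Xᴴ := by rw [h]; noncomm_ring
    rw [this]
    exact Matrix.PosDef.one.add_posSemidef (Matrix.posSemidef_self_mul_conjTranspose X)
  have h2 := (Matrix.isUnit_iff_isUnit_det _).1 h1.isUnit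
  rw [Matrix.det_mul] at h2
  exact isUnit_of_mul_isUnit_left h2

/-- The Cayley transform from `sp(N)` to `Sp(N)`. -/
def cayley (X : spAlgebra ι) : Sp ι :=
  ⟨⟨(1 - X.1)⁻¹ * (1 + X.1), by
    have hX := ((mem_spAlgebra_iff X.1).1 X.2).2
    have h1 : IsUnit (1 - X.1).det := isUnit_one_sub hX
    have h2 : IsUnit (1 + X.1).det := by
      have := isUnit_one_sub (X := -X.1) (by rw [Matrix.conjTranspose_neg, hX])
      rwa [sub_neg_eq_add] at this
    rw [Matrix.mem_unitaryGroup_iff, Matrix.star_eq_conjTranspose, Matrix.conjTranspose_mul,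
      Matrix.conjTranspose_nonsing_inv, Matrix.conjTranspose_sub, Matrix.conjTranspose_add, hX,
      Matrix.conjTranspose_one, sub_neg_eq_add, ← sub_eq_add_neg]
    calc _ = (1 - X.1)⁻¹ * ((1 + X.1) * (1 - X.1)) * (1 + X.1)⁻¹ := by
            simp only [Matrix.mul_assoc]
      _ = (1 - X.1)⁻¹ * ((1 - X.1) * (1 + X.1)) * (1 + X.1)⁻¹ := by congr 2; noncomm_ring
      _ = ((1 - X.1)⁻¹ * (1 - X.1)) * ((1 + X.1) * (1 + X.1)⁻¹) := by
            simp only [Matrix.mul_assoc]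
      _ = 1 := by rw [Matrix.nonsing_inv_mul _ h1, Matrix.mul_nonsing_inv _ h2, Matrix.one_mul]⟩,
  by
    have hX := ((mem_spAlgebra_iff X.1).1 X.2).1
    have h1 : ∃ z w : Matrix ι ι ℂ, (1 : Matrix (ι ⊕ ι) (ι ⊕ ι) ℂ) = quatMatrix z w :=
      ⟨1, 0, quatMatrix_one⟩
    refine isQuat_mul (isQuat_inv ?_) (isQuat_add h1 hX)
    rw [sub_eq_add_neg]
    exact isQuat_add h1 (isQuat_neg hX)⟩

lemma toMatrix_cayley (X : spAlgebra ι) : toMatrix (cayley X) = (1 - X.1)⁻¹ * (1 + X.1) := rfl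

/-- The inverse Cayley transform, with value `0` where `u + 1` is not invertible. -/
def cayleyInv (u : Sp ι) : spAlgebra ι :=
  ⟨(toMatrix u - 1) * (toMatrix u + 1)⁻¹, by
    by_cases h : IsUnit (toMatrix u + 1).det
    · have hu : ∃ z w : Matrix ι ι ℂ, toMatrix u = quatMatrix z w := u.2
      have h1 : ∃ z w : Matrix ι ι ℂ, (1 : Matrix (ι ⊕ ι) (ι ⊕ ι) ℂ) = quatMatrix z w :=
        ⟨1, 0, quatMatrix_one⟩
      rw [mem_spAlgebra_iff]
      refine ⟨isQuat_mul ?_ (isQuat_inv (isQuat_add hu h1)), ?_⟩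
      · rw [sub_eq_add_neg]
        exact isQuat_add hu (isQuat_neg h1)
      · have huu : (toMatrix u)ᴴ * toMatrix u = 1 := toMatrix_inv_mul u
        set U := toMatrix u
        have hU : IsUnit (Uᴴ + 1).det := by
          have : Uᴴ + 1 = (U + 1)ᴴ := by simp
          rw [this, Matrix.det_conjTranspose]
          exact h.star
        rw [Matrix.conjTranspose_mul, Matrix.conjTranspose_nonsing_inv]
        simp only [Matrix.conjTranspose_add, Matrix.conjTranspose_sub, Matrix.conjTranspose_one]
        have key : (Uᴴ - 1) * (U + 1) = -((Uᴴ + 1) * (U - 1)) := by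
          have e1 : (Uᴴ - 1) * (U + 1) = Uᴴ * U + Uᴴ - U - 1 := by noncomm_ring
          have e2 : (Uᴴ + 1) * (U - 1) = Uᴴ * U - Uᴴ + U - 1 := by noncomm_ring
          rw [e1, e2, huu]; abel
        calc (Uᴴ + 1)⁻¹ * (Uᴴ - 1)
            = (Uᴴ + 1)⁻¹ * ((Uᴴ - 1) * (U + 1)) * (U + 1)⁻¹ := by
              rw [Matrix.mul_assoc, Matrix.mul_assoc, Matrix.mul_nonsing_inv _ h, Matrix.mul_one]
          _ = -(((Uᴴ + 1)⁻¹ * (Uᴴ + 1)) * ((U - 1) * (U + 1)⁻¹)) := by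
              rw [key]; simp only [Matrix.mul_assoc, Matrix.mul_neg, Matrix.neg_mul]
          _ = _ := by rw [Matrix.nonsing_inv_mul _ hU, Matrix.one_mul]
    · rw [Matrix.nonsing_inv_apply_not_isUnit _ h, Matrix.mul_zero]
      exact zero_mem _⟩

lemma one_sub_inv_two {X : Matrix (ι ⊕ ι) (ι ⊕ ι) ℂ} (h1 : IsUnit (1 - X).det) :
    (1 - X)⁻¹ * (1 + X) + 1 = (2 : ℂ) • (1 - X)⁻¹ := by
  have : (1 + X : Matrix (ι ⊕ ι) (ι ⊕ ι) ℂ) = (2 : ℂ) • 1 - (1 - X) := by rw [two_smul]; abel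
  rw [this, Matrix.mul_sub, Matrix.nonsing_inv_mul _ h1]
  simp

lemma isUnit_cayley_add_one (X : spAlgebra ι) : IsUnit (toMatrix (cayley X) + 1).det := by
  have h1 : IsUnit (1 - X.1).det := isUnit_one_sub ((mem_spAlgebra_iff X.1).1 X.2).2
  rw [toMatrix_cayley, one_sub_inv_two h1, Matrix.det_smul]
  refine IsUnit.mul (by simp) ?_
  exact Matrix.isUnit_nonsing_inv_det _ h1

lemma cayleyInv_cayley (X : spAlgebra ι) : cayleyInv (cayley X) = X := by
  have h1 : IsUnit (1 - X.1).det := isUnit_one_sub ((mem_spAlgebra_iff X.1).1 X.2).2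
  have h2 := isUnit_cayley_add_one X
  apply Subtype.ext
  change (toMatrix (cayley X) - 1) * (toMatrix (cayley X) + 1)⁻¹ = X.1
  suffices h : toMatrix (cayley X) - 1 = X.1 * (toMatrix (cayley X) + 1) by
    rw [h, Matrix.mul_assoc, Matrix.mul_nonsing_inv _ h2, Matrix.mul_one]
  rw [toMatrix_cayley, one_sub_inv_two h1]
  have hc : (1 - X.1)⁻¹ * (1 + X.1) - 1 = (2 : ℂ) • ((1 - X.1)⁻¹ * X.1) := by
    have : (1 + X.1 : Matrix (ι ⊕ ι) (ι ⊕ ι) ℂ) = (1 - X.1) + (2 : ℂ) • X.1 := by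
      rw [two_smul]; abel
    rw [this, Matrix.mul_add, Matrix.nonsing_inv_mul _ h1, add_sub_cancel_left, Matrix.mul_smul]
  rw [hc, Matrix.mul_smul]
  congr 1
  calc (1 - X.1)⁻¹ * X.1 = (1 - X.1)⁻¹ * (X.1 * (1 - X.1)) * (1 - X.1)⁻¹ := by
          rw [Matrix.mul_assoc, Matrix.mul_assoc, Matrix.mul_nonsing_inv _ h1, Matrix.mul_one]
    _ = (1 - X.1)⁻¹ * ((1 - X.1) * X.1) * (1 - X.1)⁻¹ := by congr 2; noncomm_ring
    _ = _ := by rw [← Matrix.mul_assoc, Matrix.nonsing_inv_mul _ h1, Matrix.one_mul]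

lemma toMatrix_injective : Function.Injective (toMatrix (ι := ι)) := fun _ _ h =>
  Subtype.ext (Subtype.ext h)

lemma cayley_cayleyInv (u : Sp ι) (h : IsUnit (toMatrix u + 1).det) :
    cayley (cayleyInv u) = u := by
  apply toMatrix_injective
  set X := cayleyInv u
  have h1 : IsUnit (1 - X.1).det := isUnit_one_sub ((mem_spAlgebra_iff X.1).1 X.2).2
  have hX : X.1 * (toMatrix u + 1) = toMatrix u - 1 := by
    change (toMatrix u - 1) * (toMatrix u + 1)⁻¹ * (toMatrix u + 1) = _
    rw [Matrix.mul_assoc, Matrix.nonsing_inv_mul _ h, Matrix.mul_one]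
  rw [toMatrix_cayley]
  have h3 : 1 + X.1 = (1 - X.1) * toMatrix u := by
    rw [Matrix.mul_add, Matrix.mul_one] at hX
    rw [Matrix.sub_mul, Matrix.one_mul, eq_sub_of_add_eq hX]
    abel
  rw [h3, ← Matrix.mul_assoc, Matrix.nonsing_inv_mul _ h1, Matrix.one_mul]

lemma continuous_toMatrix : Continuous (toMatrix (ι := ι)) :=
  continuous_subtype_val.comp continuous_subtype_val

lemma contDiff_det {d : ℕ} {κ : Type*} [Fintype κ] [DecidableEq κ]
    {A : (Fin d → ℝ) → Matrix κ κ ℂ} (h : ∀ a b, ContDiff ℝ ∞ fun x => A x a b) :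
    ContDiff ℝ ∞ fun x => (A x).det := by
  simp only [Matrix.det_apply]
  refine ContDiff.sum fun σ _ => ?_
  exact ContDiff.const_smul _ (contDiff_prod fun i _ => h _ _)

lemma contDiff_inv {d : ℕ} {κ : Type*} [Fintype κ] [DecidableEq κ]
    {A : (Fin d → ℝ) → Matrix κ κ ℂ} (h : ∀ a b, ContDiff ℝ ∞ fun x => A x a b)
    (hu : ∀ x, IsUnit (A x).det) (a b : κ) : ContDiff ℝ ∞ fun x => (A x)⁻¹ a b := by
  simp only [Matrix.inv_def, Ring.inverse_eq_inv', Matrix.smul_apply, smul_eq_mul,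
    Matrix.adjugate_apply]
  refine ((contDiff_det h).inv fun x => (hu x).ne_zero).mul (contDiff_det fun i j => ?_)
  by_cases hi : i = b
  · subst hi; simp only [Matrix.updateRow_self]; exact contDiff_const
  · simp only [Matrix.updateRow_ne hi]; exact h i j

/-- A linear coordinate system on the Lie algebra. -/
def coords (ι : Type*) [Fintype ι] [DecidableEq ι] :
    spAlgebra ι ≃ₗ[ℝ] (Fin (dimSp ι) → ℝ) :=
  (Module.finBasis ℝ (spAlgebra ι)).equivFun

lemma contDiff_coords_symm (a b : ι ⊕ ι) :
    ContDiff ℝ ∞ fun x => ((coords ι).symm x).1 a b := by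
  let f : (Fin (dimSp ι) → ℝ) →ₗ[ℝ] ℂ :=
    { toFun := fun x => ((coords ι).symm x).1 a b
      map_add' := fun x y => by simp
      map_smul' := fun c x => by simp }
  exact (LinearMap.toContinuousLinearMap f).contDiff

lemma contDiff_cayley (a b : ι ⊕ ι) :
    ContDiff ℝ ∞ fun x => toMatrix (cayley ((coords ι).symm x)) a b := by
  simp only [toMatrix_cayley, Matrix.mul_apply]
  refine ContDiff.sum fun k _ => ?_
  refine (contDiff_inv (fun i j => ?_) (fun x => ?_) a k).mul ?_
  · simp only [Matrix.sub_apply]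
    exact contDiff_const.sub (contDiff_coords_symm i j)
  · exact isUnit_one_sub ((mem_spAlgebra_iff _).1 ((coords ι).symm x).2).2
  · simp only [Matrix.add_apply]
    exact contDiff_const.add (contDiff_coords_symm k b)

lemma continuous_to_Sp {Y : Type*} [TopologicalSpace Y] {f : Y → Sp ι}
    (h : ∀ a b, Continuous fun y => toMatrix (f y) a b) : Continuous f := by
  refine Continuous.subtype_mk (Continuous.subtype_mk (f := fun y => toMatrix (f y)) ?_ _) _
  exact continuous_matrix h

/-- The chart of `Sp(N)` around `p` given by the Cayley transform. -/
def cayleyChart (p : Sp ι) : Chart ι where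
  toFun q := coords ι (cayleyInv (p⁻¹ * q))
  invFun x := p * cayley ((coords ι).symm x)
  source := {q | (toMatrix (p⁻¹ * q) + 1).det ≠ 0}
  target := Set.univ
  map_source' _ _ := Set.mem_univ _
  map_target' x _ := by
    simpa using (isUnit_cayley_add_one ((coords ι).symm x)).ne_zero
  left_inv' q hq := by
    simp only [LinearEquiv.symm_apply_apply]
    rw [cayley_cayleyInv _ (isUnit_iff_ne_zero.2 hq), mul_inv_cancel_left]
  right_inv' x _ := by
    simp only [inv_mul_cancel_left, cayleyInv_cayley, LinearEquiv.apply_symm_apply]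
  open_source := by
    refine isOpen_ne_fun ?_ continuous_const
    simp only [toMatrix_mul]
    exact ((continuous_const.matrix_mul continuous_toMatrix).add continuous_const).matrix_det
  open_target := isOpen_univ
  continuousOn_toFun := by
    refine (LinearMap.continuous_of_finiteDimensional
      (coords ι).toLinearMap).comp_continuousOn ?_
    rw [Topology.IsInducing.subtypeVal.continuousOn_iff]
    change ContinuousOn (fun q => (toMatrix (p⁻¹ * q) - 1) * (toMatrix (p⁻¹ * q) + 1)⁻¹) _
    have h0 : Continuous fun q : Sp ι => toMatrix (p⁻¹ * q) := by
      simp only [toMatrix_mul]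
      exact continuous_const.matrix_mul continuous_toMatrix
    refine ContinuousOn.mul (h0.sub continuous_const).continuousOn ?_
    simp only [Matrix.inv_def, Ring.inverse_eq_inv']
    refine ContinuousOn.smul (ContinuousOn.inv₀ ?_ fun q hq => hq) ?_
    · exact ((h0.add continuous_const).matrix_det).continuousOn
    · exact ((h0.add continuous_const).matrix_adjugate).continuousOn
  continuousOn_invFun := by
    refine Continuous.continuousOn (continuous_to_Sp fun a b => ?_)
    simp only [toMatrix_mul, Matrix.mul_apply]
    exact continuous_finsetSum _ fun k _ => continuous_const.mul (contDiff_cayley k b).continuous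

/-- `Sp(N)` is covered by smooth charts. -/
theorem exists_isSmoothChart (p : Sp ι) : ∃ e : Chart ι, IsSmoothChart e ∧ p ∈ e.source := by
  have hparam : ∀ x, param (cayleyChart p) x =
      toMatrix p * toMatrix (cayley ((coords ι).symm x)) := fun x => rfl
  have hsm : ContDiff ℝ ∞ (param (cayleyChart p)) := by
    refine contDiff_pi.2 fun a => contDiff_pi.2 fun b => ?_
    simp only [hparam, Matrix.mul_apply]
    exact ContDiff.sum fun k _ => contDiff_const.mul (contDiff_cayley k b)
  refine ⟨cayleyChart p, ⟨hsm.contDiffOn, fun x _ => ?_⟩, ?_⟩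
  · rw [injective_iff_map_eq_zero]
    intro v hv
    have hF : ∀ a b, HasDerivAt (fun t : ℝ => param (cayleyChart p) (x + t • v) a b) 0 0 := by
      intro a b
      have h1 : HasFDerivAt (param (cayleyChart p)) (fderiv ℝ (param (cayleyChart p)) x)
          (x + (0 : ℝ) • v) := by
        rw [zero_smul, add_zero]
        exact (hsm.differentiable (by simp) x).hasFDerivAt
      have h2 : HasDerivAt (fun t : ℝ => x + t • v) v 0 := by
        simpa using ((hasDerivAt_id (0 : ℝ)).smul_const v).const_add x
      have h3 := h1.comp_hasDerivAt (0 : ℝ) h2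
      rw [hv] at h3
      exact hasDerivAt_pi.1 (hasDerivAt_pi.1 h3 a) b
    set X : ℝ → spAlgebra ι := fun t => (coords ι).symm (x + t • v) with hXdef
    set V := (coords ι).symm v with hV
    set u := toMatrix (cayley ((coords ι).symm x))
    have hXt : ∀ t a b, (X t).1 a b = ((coords ι).symm x).1 a b + t * V.1 a b := by
      intro t a b; simp [X, V]
    have hX' : ∀ a b, HasDerivAt (fun t => (X t).1 a b) (V.1 a b) 0 := by
      intro a b
      simp only [hXt]
      have : HasDerivAt (fun t : ℝ => (t : ℂ)) 1 0 := Complex.ofRealCLM.hasDerivAt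
      simpa using (this.mul_const (V.1 a b)).const_add (((coords ι).symm x).1 a b)
    have hc : ∀ a b, HasDerivAt (fun t => toMatrix (cayley (X t)) a b) 0 0 := by
      intro a b
      have h1 : ∀ t, toMatrix (cayley (X t)) a b =
          ∑ k, toMatrix p⁻¹ a k * param (cayleyChart p) (x + t • v) k b := by
        intro t
        rw [hparam, ← Matrix.mul_apply, ← Matrix.mul_assoc, toMatrix_inv_mul, Matrix.one_mul]
      simp only [h1]
      have := HasDerivAt.fun_sum (u := Finset.univ)
        fun k (_ : k ∈ Finset.univ) => (hF k b).const_mul (toMatrix p⁻¹ a k)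
      simpa using this
    have heq : ∀ t a b, ∑ k, (1 - (X t).1) a k * toMatrix (cayley (X t)) k b =
        (1 + (X t).1) a b := by
      intro t a b
      rw [← Matrix.mul_apply, toMatrix_cayley, ← Matrix.mul_assoc, Matrix.mul_nonsing_inv _
        (isUnit_one_sub ((mem_spAlgebra_iff _).1 (X t).2).2), Matrix.one_mul]
    have hX0 : X 0 = (coords ι).symm x := by simp [X]
    have hmain : V.1 * (u + 1) = 0 := by
      ext a b
      have hl : HasDerivAt (fun t => ∑ k, (1 - (X t).1) a k * toMatrix (cayley (X t)) k b)
          (∑ k, (-(V.1 a k) * toMatrix (cayley (X 0)) k b + (1 - (X 0).1) a k * 0)) 0 := by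
        refine HasDerivAt.fun_sum fun k _ => ?_
        exact ((hX' a k).const_sub _).mul (hc k b)
      have hr : HasDerivAt (fun t => (1 + (X t).1) a b) (V.1 a b) 0 := (hX' a b).const_add _
      simp only [heq] at hl
      have := hl.unique hr
      rw [hX0] at this
      simp only [mul_zero, add_zero, neg_mul, Finset.sum_neg_distrib] at this
      rw [Matrix.mul_add, Matrix.mul_one, Matrix.add_apply, Matrix.mul_apply, ← this]
      simp [u]
    have hV0 : V.1 = 0 := by
      have h := isUnit_cayley_add_one ((coords ι).symm x)
      calc V.1 = V.1 * (u + 1) * (u + 1)⁻¹ := by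
            rw [Matrix.mul_assoc, Matrix.mul_nonsing_inv _ h, Matrix.mul_one]
        _ = 0 := by rw [hmain, Matrix.zero_mul]
    have : V = 0 := Subtype.ext hV0
    simpa [V] using this
  · change (toMatrix (p⁻¹ * p) + 1).det ≠ 0
    have : (toMatrix (p⁻¹ * p) + 1) = (2 : ℂ) • (1 : Matrix (ι ⊕ ι) (ι ⊕ ι) ℂ) := by
      rw [toMatrix_mul, toMatrix_inv_mul, two_smul]
    rw [this, Matrix.det_smul]
    simp

end Existence

/-- The partial derivative `∂f/∂x_i` of a function on `ℝ^d`. -/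
def partialDeriv {d : ℕ} {F : Type*} [NormedAddCommGroup F] [NormedSpace ℝ F] (i : Fin d)
    (f : (Fin d → ℝ) → F) (x : Fin d → ℝ) : F :=
  fderiv ℝ f x (Pi.single i 1)

/-- The coordinate vector field `∂/∂x_i` of a chart as a matrix. -/
def coordVector (e : Chart ι) (i : Fin (dimSp ι)) (x : Fin (dimSp ι) → ℝ) :
    Matrix (ι ⊕ ι) (ι ⊕ ι) ℂ :=
  Matrix.of (partialDeriv i (param e) x)

/-- The matrix `(g_ij)` of the metric in local coordinates. -/
def gram (e : Chart ι) (x : Fin (dimSp ι) → ℝ) : Matrix (Fin (dimSp ι)) (Fin (dimSp ι)) ℝ :=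
  Matrix.of fun i j => metric (e.symm x) (coordVector e i x) (coordVector e j x)

/-- The Laplace-Beltrami operator (tension field) on `Sp(N)` in the local coordinates `e`:
`τ(φ) = ∑ i j, (1 / √|g|) ∂/∂x_j (g^{ij} √|g| ∂φ/∂x_i)`. -/
def tension (e : Chart ι) (φ : Sp ι → ℂ) (q : Sp ι) : ℂ :=
  ∑ i, ∑ j, (1 / √(gram e (e q)).det) •
    partialDeriv j (fun y => ((gram e y)⁻¹ i j * √(gram e y).det) •
      partialDeriv i (φ ∘ e.symm) y) (e q)

/-- The conformality operator on `Sp(N)` in the local coordinates `e`: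
`κ(φ, ψ) = ∑ i j, g^{ij} ∂φ/∂x_i ∂ψ/∂x_j`. -/
def conformality (e : Chart ι) (φ ψ : Sp ι → ℂ) (q : Sp ι) : ℂ :=
  ∑ i, ∑ j, (gram e (e q))⁻¹ i j •
    (partialDeriv i (φ ∘ e.symm) (e q) * partialDeriv j (ψ ∘ e.symm) (e q))

/-- `I_{m,n} = diag(I_m, -I_n)`. -/
def signMatrix (m n : ℕ) : Matrix (Fin m ⊕ Fin n) (Fin m ⊕ Fin n) ℂ :=
  Matrix.fromBlocks 1 0 0 (-1)

/-- `Î_{m,n} = diag(I_{m,n}, I_{m,n})`. -/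
def hatI (m n : ℕ) :
    Matrix ((Fin m ⊕ Fin n) ⊕ (Fin m ⊕ Fin n)) ((Fin m ⊕ Fin n) ⊕ (Fin m ⊕ Fin n)) ℂ :=
  Matrix.fromBlocks (signMatrix m n) 0 0 (signMatrix m n)

/-- The function `ψ̂_{jα}(q) = ½ (q Î_{m,n} q̄ᵗ + I)_{jα}` on `Sp(m+n)`. -/
def psiHat (m n : ℕ) (j α : (Fin m ⊕ Fin n) ⊕ (Fin m ⊕ Fin n)) (q : Sp (Fin m ⊕ Fin n)) : ℂ :=
  (1 / 2) * (toMatrix q * hatI m n * (toMatrix q)ᴴ + 1) j α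

end QuaternionicUnitary

end

/-! Because the metric is bi-invariant, an orthonormal basis `Z a` of sp(N) for Re tr(X Yᴴ) extends
to the right-invariant orthonormal frame q ↦ `Z a` q. The structure constants satisfy ∑_c ⟨[Z_a,
Z_c], Z_c⟩ = 0, so these fields are divergence free. Hence τ is the sum of their squares and κ(φ, ψ)
= ∑_a Z_a(φ) Z_a(ψ).

In a chart, `frameCoeff` is the matrix B that expresses the coordinate fields in this frame. Then g
= B Bᵀ and √|g| = |det B|. By the Maurer-Cartan equation, the divergence condition on B becomes the
trace identity above. `laplacian_eq_sum_frame` and `sum_inv_gram_smul` carry out the passage from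
coordinates to the frame.

Off the diagonal, ψ̂ is half an entry of F = q Î qᴴ, and the frame acts on F by commutators: Z_a(F)
= [Z_a, F]. What remains is linear algebra in sp(N), governed by the completeness relation ∑ tr(M
Z_a) Z_a = -½(M + J Mᵀ J), where J is the symplectic matrix. Since F J = J Fᵀ, the relation gives ∑
[Z_a, [Z_a, F]] = -2N F + tr(F) 1 (`sum_lie_lie`), and the identity term does not reach off-diagonal
entries. Since moreover F² = 1, it gives ∑ [Z_a, F]_{jα} [Z_a, F]_{kα} = -F_{jα} F_{kα}
(`sum_lie_apply_mul_lie_apply`). -/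

open scoped ContDiff Matrix

noncomputable section

namespace QuaternionicUnitary

set_option linter.unusedSectionVars false

/-! ### Derivatives of determinants and inverse matrices. -/

section Calculus

open Matrix Topology Filter

variable {E n : Type*} [NormedAddCommGroup E] [NormedSpace ℝ E] [Fintype n] [DecidableEq n]

/-- Jacobi's formula for the derivative of a determinant. -/
lemma hasFDerivAt_det {B : E → Matrix n n ℝ} {B' : n → n → E →L[ℝ] ℝ} {x : E}
    (h : ∀ i j, HasFDerivAt (fun y => B y i j) (B' i j) x) :
    HasFDerivAt (fun y => (B y).det) (∑ i, ∑ k, (B x).adjugate i k • B' k i) x := by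
  have h1 : HasFDerivAt (fun y => (B y).det)
      (∑ σ : Equiv.Perm n, Equiv.Perm.sign σ •
        ∑ i, (∏ j ∈ Finset.univ.erase i, B x (σ j) j) • B' (σ i) i) x := by
    simp only [Matrix.det_apply]
    refine HasFDerivAt.fun_sum fun σ _ => ?_
    exact (HasFDerivAt.finsetProd fun i _ => h (σ i) i).const_smul _
  convert h1 using 1
  ext v
  simp only [_root_.sum_apply, _root_.smul_apply, Finset.smul_sum, smul_eq_mul]
  rw [Finset.sum_comm (s := (Finset.univ : Finset (Equiv.Perm n)))]
  refine Finset.sum_congr rfl fun i _ => ?_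
  -- Cramer's rule: pairing row i of the adjugate with a vector is the determinant with column i
  -- replaced by that vector, whose Leibniz expansion matches term by term.
  have h2 : ∑ k, (B x).adjugate i k * B' k i v =
      ((B x).updateCol i fun k => B' k i v).det := by
    rw [← Matrix.cramer_apply, Matrix.cramer_eq_adjugate_mulVec]
    rfl
  rw [h2, Matrix.det_apply]
  refine Finset.sum_congr rfl fun σ _ => ?_
  congr 1
  rw [← Finset.prod_erase_mul _ _ (Finset.mem_univ i), Matrix.updateCol_self]
  congr 1
  exact Finset.prod_congr rfl fun j hj => Matrix.updateCol_ne (Finset.ne_of_mem_erase hj)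

/-- Logarithmic form of Jacobi's formula, d log|det B| = tr(B⁻¹ dB). The absolute value is what √|g|
produces when g = B Bᵀ. -/
lemma hasFDerivAt_abs_det {B : E → Matrix n n ℝ} {B' : n → n → E →L[ℝ] ℝ} {x : E}
    (h : ∀ i j, HasFDerivAt (fun y => B y i j) (B' i j) x) (h0 : (B x).det ≠ 0) :
    HasFDerivAt (fun y => |(B y).det|)
      (|(B x).det| • ∑ i, ∑ k, (B x)⁻¹ i k • B' k i) x := by
  convert (hasFDerivAt_det h).abs h0 using 1
  have : (B x).adjugate = (B x).det • (B x)⁻¹ := by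
    rw [Matrix.inv_def, Ring.inverse_eq_inv', smul_smul, mul_inv_cancel₀ h0, one_smul]
  rw [this]
  simp only [Matrix.smul_apply, smul_eq_mul, mul_smul, ← Finset.smul_sum]
  ext v
  simp
  rw [← self_mul_sign]
  ring

lemma differentiableAt_inv_apply {B : E → Matrix n n ℝ} {x : E}
    (h : ∀ i j, DifferentiableAt ℝ (fun y => B y i j) x) (h0 : (B x).det ≠ 0) (a j : n) :
    DifferentiableAt ℝ (fun y => (B y)⁻¹ a j) x := by
  have hdet : ∀ A : E → Matrix n n ℝ, (∀ i j, DifferentiableAt ℝ (fun y => A y i j) x) →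
      DifferentiableAt ℝ (fun y => (A y).det) x := fun A hA =>
    (hasFDerivAt_det fun i j => (hA i j).hasFDerivAt).differentiableAt
  simp only [Matrix.inv_def, Ring.inverse_eq_inv', Matrix.smul_apply, smul_eq_mul,
    Matrix.adjugate_apply]
  refine ((hdet B h).inv h0).mul (hdet _ fun i k => ?_)
  by_cases hi : i = j
  · subst hi; simp only [Matrix.updateRow_self]; exact differentiableAt_const _
  · simp only [Matrix.updateRow_ne hi]; exact h i k

lemma eventually_det_ne_zero {B : E → Matrix n n ℝ} {x : E}
    (h : ∀ i j, DifferentiableAt ℝ (fun y => B y i j) x) (h0 : (B x).det ≠ 0) :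
    ∀ᶠ y in 𝓝 x, (B y).det ≠ 0 :=
  (hasFDerivAt_det fun i j => (h i j).hasFDerivAt).continuousAt.eventually_ne h0

/-- Differentiate B⁻¹ B = 1, which holds on a neighbourhood of x because the determinant stays
nonzero there. -/
lemma fderiv_inv_apply {B : E → Matrix n n ℝ} {B' : n → n → E →L[ℝ] ℝ} {x : E}
    (h : ∀ i j, HasFDerivAt (fun y => B y i j) (B' i j) x) (h0 : (B x).det ≠ 0) (a j : n) (v : E) :
    fderiv ℝ (fun y => (B y)⁻¹ a j) x v =
      -((B x)⁻¹ * (Matrix.of fun i c => B' i c v) * (B x)⁻¹) a j := by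
  have hd := fun i j => (h i j).differentiableAt
  set C' : Matrix n n ℝ := Matrix.of fun a j => fderiv ℝ (fun y => (B y)⁻¹ a j) x v with hC'
  have h1 : C' * B x + (B x)⁻¹ * (Matrix.of fun i c => B' i c v) = 0 := by
    ext a c
    have e1 : HasFDerivAt (fun y => ∑ i, (B y)⁻¹ a i * B y i c)
        (∑ i, ((B x)⁻¹ a i • B' i c + B x i c • fderiv ℝ (fun y => (B y)⁻¹ a i) x)) x :=
      HasFDerivAt.fun_sum fun i _ => (differentiableAt_inv_apply hd h0 a i).hasFDerivAt.mul (h i c)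
    have e2 : (fun y => ∑ i, (B y)⁻¹ a i * B y i c) =ᶠ[𝓝 x] fun _ => (1 : Matrix n n ℝ) a c := by
      filter_upwards [eventually_det_ne_zero hd h0] with y hy
      rw [← Matrix.mul_apply, Matrix.nonsing_inv_mul _ (isUnit_iff_ne_zero.2 hy)]
    have e3 := e1.unique ((hasFDerivAt_const _ x).congr_of_eventuallyEq e2)
    have e4 := congrArg (fun f => f v) e3
    simp only [_root_.sum_apply, _root_.add_apply, _root_.smul_apply, smul_eq_mul,
      _root_.zero_apply, Finset.sum_add_distrib] at e4
    simp only [Matrix.add_apply, Matrix.mul_apply, Matrix.zero_apply, hC', Matrix.of_apply]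
    rw [add_comm, ← e4]
    congr 1
    exact Finset.sum_congr rfl fun i _ => mul_comm _ _
  have h2 : C' = -((B x)⁻¹ * (Matrix.of fun i c => B' i c v) * (B x)⁻¹) := by
    rw [← eq_neg_iff_add_eq_zero] at h1
    calc C' = C' * B x * (B x)⁻¹ := by
          rw [Matrix.mul_assoc, Matrix.mul_nonsing_inv _ (isUnit_iff_ne_zero.2 h0), Matrix.mul_one]
      _ = _ := by rw [h1, Matrix.neg_mul]
  exact congrFun (congrFun h2 a) j

end Calculus

/-! ### Laplacian and gradient pairing in an orthonormal frame. -/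

section Frame

open Matrix Topology Filter

variable {d : ℕ}

/-- A frame of vector fields is divergence free for the volume that it defines, if the structure
functions of the coframe `B` are traceless. -/
lemma sum_partialDeriv_abs_det_mul_inv {B : (Fin d → ℝ) → Matrix (Fin d) (Fin d) ℝ}
    {x : Fin d → ℝ} (h : ∀ i j, DifferentiableAt ℝ (fun y => B y i j) x) (h0 : (B x).det ≠ 0)
    (a : Fin d)
    (ht : ∑ i, ∑ j, ∑ c, (B x)⁻¹ a j * (B x)⁻¹ c i *
      (partialDeriv j (fun y => B y i c) x - partialDeriv i (fun y => B y j c) x) = 0) :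
    ∑ j, partialDeriv j (fun y => |(B y).det| * (B y)⁻¹ a j) x = 0 := by
  have h' := fun i j => (h i j).hasFDerivAt
  have h1 : ∀ j, partialDeriv j (fun y => |(B y).det| * (B y)⁻¹ a j) x =
      |(B x).det| * ((∑ i, ∑ c, (B x)⁻¹ a j * (B x)⁻¹ c i * partialDeriv j (fun y => B y i c) x)
        - ∑ i, ∑ c, (B x)⁻¹ a i * (B x)⁻¹ c j * partialDeriv j (fun y => B y i c) x) := by
    intro j
    unfold partialDeriv
    rw [((hasFDerivAt_abs_det h' h0).fun_mul
      (differentiableAt_inv_apply h h0 a j).hasFDerivAt).fderiv]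
    simp only [_root_.add_apply, _root_.smul_apply, smul_eq_mul]
    rw [fderiv_inv_apply h' h0]
    simp only [_root_.sum_apply, _root_.smul_apply, smul_eq_mul, Matrix.mul_apply, Matrix.of_apply]
    rw [Finset.sum_comm (f := fun i k => (B x)⁻¹ i k * _), mul_sub, sub_eq_neg_add, mul_neg]
    congr 1
    · congr 2
      rw [Finset.sum_comm]
      refine Finset.sum_congr rfl fun i _ => ?_
      rw [Finset.sum_mul]
      exact Finset.sum_congr rfl fun c _ => by ring
    · rw [mul_left_comm, Finset.mul_sum]
      congr 1
      refine Finset.sum_congr rfl fun i _ => ?_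
      rw [Finset.mul_sum]
      exact Finset.sum_congr rfl fun c _ => by ring
  simp only [h1]
  -- After exchanging the names i and j, the two sums are the two halves of the antisymmetrised
  -- derivative in `ht`.
  rw [← Finset.mul_sum, Finset.sum_sub_distrib]
  simp only [mul_sub, Finset.sum_sub_distrib] at ht
  rw [Finset.sum_comm, ht, mul_zero]

/-- The module is arbitrary because the inversion is applied both to complex derivatives and to
matrices in sp(N). -/
lemma sum_inv_smul_sum_smul {V : Type*} [AddCommGroup V] [Module ℝ V]
    {A : Matrix (Fin d) (Fin d) ℝ} (h0 : A.det ≠ 0) (f : Fin d → V)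
    (b : Fin d) : ∑ i, A⁻¹ b i • ∑ a, A i a • f a = f b := by
  simp only [Finset.smul_sum, smul_smul]
  rw [Finset.sum_comm]
  simp only [← Finset.sum_smul, ← Matrix.mul_apply]
  rw [Matrix.nonsing_inv_mul _ (isUnit_iff_ne_zero.2 h0)]
  simp [Matrix.one_apply, ite_smul]

lemma inv_mul_transpose_apply (A : Matrix (Fin d) (Fin d) ℝ) (i j : Fin d) :
    (A * Aᵀ)⁻¹ i j = ∑ b, A⁻¹ b i * A⁻¹ b j := by
  rw [Matrix.mul_inv_rev, ← Matrix.transpose_nonsing_inv, Matrix.mul_apply]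
  rfl

lemma sqrt_det_mul_transpose (A : Matrix (Fin d) (Fin d) ℝ) : √(A * Aᵀ).det = |A.det| := by
  rw [Matrix.det_mul, Matrix.det_transpose, Real.sqrt_mul_self_eq_abs]

/-- The pairing of differentials in terms of an orthonormal frame. -/
lemma sum_inv_gram_smul {A : Matrix (Fin d) (Fin d) ℝ} (h0 : A.det ≠ 0) (f g : Fin d → ℂ) :
    ∑ i, ∑ j, (A * Aᵀ)⁻¹ i j • ((∑ a, A i a • f a) * ∑ a, A j a • g a) = ∑ b, f b * g b := by
  simp only [inv_mul_transpose_apply, Finset.sum_smul]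
  have h1 : ∀ b, f b * g b = ∑ i, ∑ j, (A⁻¹ b i * A⁻¹ b j) •
      ((∑ a, A i a • f a) * ∑ a, A j a • g a) := by
    intro b
    conv_lhs => rw [← sum_inv_smul_sum_smul h0 f b, ← sum_inv_smul_sum_smul h0 g b]
    rw [Finset.sum_mul_sum]
    simp only [smul_mul_smul_comm]
  simp only [h1]
  symm
  rw [Finset.sum_comm]
  exact Finset.sum_congr rfl fun i _ => Finset.sum_comm

/-- The Laplace-Beltrami operator in terms of a divergence free orthonormal frame. -/
lemma laplacian_eq_sum_frame {B g : (Fin d → ℝ) → Matrix (Fin d) (Fin d) ℝ}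
    {φ : (Fin d → ℝ) → ℂ} {f : Fin d → (Fin d → ℝ) → ℂ} {x : Fin d → ℝ}
    (h : ∀ i j, DifferentiableAt ℝ (fun y => B y i j) x) (h0 : (B x).det ≠ 0)
    (hdiv : ∀ a, ∑ j, partialDeriv j (fun y => |(B y).det| * (B y)⁻¹ a j) x = 0)
    (hf : ∀ a, DifferentiableAt ℝ (f a) x) (hg : ∀ᶠ y in 𝓝 x, g y = B y * (B y)ᵀ)
    (hφ : ∀ᶠ y in 𝓝 x, ∀ i, partialDeriv i φ y = ∑ a, B y i a • f a y) :
    ∑ i, ∑ j, (1 / √(g x).det) •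
      partialDeriv j (fun y => ((g y)⁻¹ i j * √(g y).det) • partialDeriv i φ y) x =
    ∑ a, ∑ j, (B x)⁻¹ a j • partialDeriv j (f a) x := by
  have hD : DifferentiableAt ℝ (fun y => |(B y).det|) x :=
    (hasFDerivAt_abs_det (fun i j => (h i j).hasFDerivAt) h0).differentiableAt
  have hC := differentiableAt_inv_apply h h0
  -- The flux g^{ij} √|g| ∂φ/∂x_i written through B; it agrees with the original only near x, which
  -- suffices for derivatives.
  set F : Fin d → Fin d → (Fin d → ℝ) → ℂ := fun i j y =>
    ((∑ b, (B y)⁻¹ b i * (B y)⁻¹ b j) * |(B y).det|) • ∑ a, B y i a • f a y with hF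
  have hFd : ∀ i j, DifferentiableAt ℝ (F i j) x := by
    intro i j
    refine DifferentiableAt.fun_smul (DifferentiableAt.fun_mul ?_ hD) ?_
    · exact DifferentiableAt.fun_sum fun b _ => (hC b i).fun_mul (hC b j)
    · exact DifferentiableAt.fun_sum fun a _ => (h i a).fun_smul (hf a)
  have h1 : ∀ i j, partialDeriv j (fun y => ((g y)⁻¹ i j * √(g y).det) • partialDeriv i φ y) x =
      partialDeriv j (F i j) x := by
    intro i j
    unfold partialDeriv
    rw [Filter.EventuallyEq.fderiv_eq]
    filter_upwards [hg, hφ] with y hy hy'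
    have := hy' i
    unfold partialDeriv at this
    rw [this, hy, inv_mul_transpose_apply, sqrt_det_mul_transpose]
  have h2 : ∀ j, ∑ i, partialDeriv j (F i j) x =
      ∑ a, (partialDeriv j (fun y => |(B y).det| * (B y)⁻¹ a j) x • f a x +
        (|(B x).det| * (B x)⁻¹ a j) • partialDeriv j (f a) x) := by
    intro j
    -- Summing over i contracts one factor B⁻¹ with B. The product rule then leaves a divergence
    -- term, removed by `hdiv`, and the wanted second-order term.
    have e1 : (fun y => ∑ i, F i j y) =ᶠ[𝓝 x]
        fun y => ∑ a, (|(B y).det| * (B y)⁻¹ a j) • f a y := by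
      filter_upwards [eventually_det_ne_zero h h0] with y hy
      simp only [hF, Finset.sum_mul, Finset.sum_smul]
      rw [Finset.sum_comm]
      refine Finset.sum_congr rfl fun b _ => ?_
      conv_rhs => rw [← sum_inv_smul_sum_smul hy (fun a => f a y) b, Finset.smul_sum]
      refine Finset.sum_congr rfl fun i _ => ?_
      rw [smul_smul]
      congr 1
      ring
    unfold partialDeriv
    have e2 := HasFDerivAt.fun_sum fun i (_ : i ∈ Finset.univ) => (hFd i j).hasFDerivAt
    have e3 := HasFDerivAt.fun_sum fun a (_ : a ∈ Finset.univ) =>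
      (hD.fun_mul (hC a j)).hasFDerivAt.fun_smul (hf a).hasFDerivAt
    have e4 := congrArg (fun A => A (Pi.single j 1)) ((e2.congr_of_eventuallyEq e1.symm).unique e3)
    simp only [_root_.sum_apply] at e4
    rw [e4]
    refine Finset.sum_congr rfl fun a _ => ?_
    simp only [_root_.add_apply, _root_.smul_apply, ContinuousLinearMap.smulRight_apply]
    rw [add_comm]
  rw [Finset.sum_comm]
  simp only [h1, ← Finset.smul_sum, h2, Finset.sum_add_distrib]
  rw [Finset.sum_comm, Finset.sum_comm (f := fun j a => (_ * (B x)⁻¹ a j) • _)]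
  simp only [← Finset.sum_smul, hdiv, zero_smul, Finset.sum_const_zero, zero_add]
  rw [hg.self_of_nhds, sqrt_det_mul_transpose]
  simp only [mul_smul, ← Finset.smul_sum]
  rw [smul_smul, one_div, inv_mul_cancel₀ (abs_ne_zero.2 h0), one_smul]

end Frame

/-! ### The symplectic form and the trace inner product on sp(N). -/

section Algebra

open Matrix

variable {ι : Type*} [Fintype ι] [DecidableEq ι]

/-- The matrix of the complex symplectic form that defines the quaternionic structure. -/
def symplJ (ι : Type*) [DecidableEq ι] : Matrix (ι ⊕ ι) (ι ⊕ ι) ℂ := Matrix.fromBlocks 0 1 (-1) 0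

lemma symplJ_mul_self : symplJ ι * symplJ ι = -1 := by
  simp [symplJ, Matrix.fromBlocks_multiply, ← Matrix.fromBlocks_one, Matrix.fromBlocks_neg]

lemma symplJ_transpose : (symplJ ι)ᵀ = -symplJ ι := by
  simp [symplJ, Matrix.fromBlocks_transpose, Matrix.fromBlocks_neg]

lemma symplJ_apply_comm (i l : ι ⊕ ι) : symplJ ι l i = -symplJ ι i l :=
  congrFun (congrFun symplJ_transpose i) l

lemma mul_single_mul_apply {κ : Type*} [Fintype κ] [DecidableEq κ] (A B : Matrix κ κ ℂ)
    (s t i j : κ) : (A * Matrix.single s t (1 : ℂ) * B : Matrix κ κ ℂ) i j = A i s * B t j := by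
  rw [Matrix.mul_assoc, Matrix.mul_apply, Finset.sum_eq_single s]
  · simp
  · intro b _ hb
    simp [hb]
  · simp

lemma symplJ_map_star : (symplJ ι).map star = symplJ ι := by
  ext i j
  rcases i with i | i <;> rcases j with j | j <;> simp [symplJ, Matrix.one_apply, apply_ite]

lemma mem_spAlgebra_iff_symplJ (X : Matrix (ι ⊕ ι) (ι ⊕ ι) ℂ) :
    X ∈ spAlgebra ι ↔ X * symplJ ι = symplJ ι * X.map star ∧ Xᴴ = -X := by
  rw [mem_spAlgebra_iff, isQuat_iff]
  rfl

/-- The inner product `Re tr (X Yᴴ)`. -/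
def traceInner {κ : Type*} [Fintype κ] (X Y : Matrix κ κ ℂ) : ℝ := (X * Yᴴ).trace.re

section TraceInner

variable {κ : Type*} [Fintype κ]

lemma traceInner_eq_sum (X Y : Matrix κ κ ℂ) :
    traceInner X Y = ∑ i, ∑ j, (X i j * star (Y i j)).re := by
  simp [traceInner, Matrix.trace, Matrix.mul_apply]

lemma traceInner_comm (X Y : Matrix κ κ ℂ) : traceInner X Y = traceInner Y X := by
  simp only [traceInner_eq_sum]
  refine Finset.sum_congr rfl fun i _ => Finset.sum_congr rfl fun j _ => ?_
  simp
  ring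

lemma traceInner_add_left (X X' Y : Matrix κ κ ℂ) :
    traceInner (X + X') Y = traceInner X Y + traceInner X' Y := by
  simp [traceInner, Matrix.add_mul]

lemma traceInner_smul_left (c : ℝ) (X Y : Matrix κ κ ℂ) :
    traceInner (c • X) Y = c * traceInner X Y := by
  simp [traceInner]

lemma traceInner_sum_smul_left {α : Type*} (s : Finset α) (c : α → ℝ) (X : α → Matrix κ κ ℂ)
    (Y : Matrix κ κ ℂ) :
    traceInner (∑ a ∈ s, c a • X a) Y = ∑ a ∈ s, c a * traceInner (X a) Y := by
  simp [traceInner, Matrix.sum_mul, Matrix.trace_sum]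

lemma traceInner_self_nonneg (X : Matrix κ κ ℂ) : 0 ≤ traceInner X X := by
  rw [traceInner_eq_sum]
  refine Finset.sum_nonneg fun i _ => Finset.sum_nonneg fun j _ => ?_
  rw [Complex.star_def, Complex.mul_conj, Complex.ofReal_re]
  exact Complex.normSq_nonneg _

lemma eq_zero_of_traceInner_self {X : Matrix κ κ ℂ} (h : traceInner X X = 0) : X = 0 := by
  have h0 : ∀ i j, 0 ≤ (X i j * star (X i j)).re := fun i j => by
    rw [Complex.star_def, Complex.mul_conj, Complex.ofReal_re]
    exact Complex.normSq_nonneg _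
  rw [traceInner_eq_sum, Finset.sum_eq_zero_iff_of_nonneg fun i _ =>
    Finset.sum_nonneg fun j _ => h0 i j] at h
  ext i j
  have h1 := h i (Finset.mem_univ i)
  rw [Finset.sum_eq_zero_iff_of_nonneg fun j _ => h0 i j] at h1
  have h2 := h1 j (Finset.mem_univ j)
  rw [Complex.star_def, Complex.mul_conj, Complex.ofReal_re] at h2
  simpa using h2

end TraceInner

/-- `Z` is an orthonormal basis of the Lie algebra `sp(N)`. -/
structure IsOrthonormalBasis (Z : Fin (dimSp ι) → Matrix (ι ⊕ ι) (ι ⊕ ι) ℂ) : Prop where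
  mem : ∀ a, Z a ∈ spAlgebra ι
  sum_smul : ∀ X ∈ spAlgebra ι, X = ∑ a, traceInner X (Z a) • Z a
  traceInner_eq : ∀ a b, traceInner (Z a) (Z b) = if a = b then 1 else 0

-- The trace form becomes an inner product through local instances. The basis is indexed like the
-- coordinates of a chart, which makes `frameCoeff` a square matrix.
variable (ι) in
lemma exists_isOrthonormalBasis :
    ∃ Z : Fin (dimSp ι) → Matrix (ι ⊕ ι) (ι ⊕ ι) ℂ, IsOrthonormalBasis Z := by
  let c : InnerProductSpace.Core ℝ (spAlgebra ι) :=
    { inner := fun X Y => traceInner X.1 Y.1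
      conj_inner_symm := fun X Y => traceInner_comm _ _
      re_inner_nonneg := fun X => traceInner_self_nonneg _
      add_left := fun X Y Z => traceInner_add_left _ _ _
      smul_left := fun X Y r => traceInner_smul_left _ _ _
      definite := fun X h => Subtype.ext (eq_zero_of_traceInner_self h) }
  let _ : NormedAddCommGroup (spAlgebra ι) := c.toNormedAddCommGroup
  let _ : InnerProductSpace ℝ (spAlgebra ι) := InnerProductSpace.ofCore c.toCore
  have hinner : ∀ X Y : spAlgebra ι, inner ℝ X Y = traceInner X.1 Y.1 := fun _ _ => rfl
  let b := stdOrthonormalBasis ℝ (spAlgebra ι)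
  refine ⟨fun a => (b a).1, fun a => (b a).2, fun X hX => ?_, fun a a' => ?_⟩
  · have h := congrArg Subtype.val (b.sum_repr' ⟨X, hX⟩)
    simp only [hinner] at h
    rw [AddSubmonoidClass.coe_finsetSum] at h
    simp only [traceInner_comm X]
    exact h.symm
  · rw [← hinner]
    exact orthonormal_iff_ite.1 b.orthonormal a a'

/-- Multiply the hypothesis by J on both sides and use J² = -1. -/
lemma symplJ_mul_eq_map_star_mul {Z : Matrix (ι ⊕ ι) (ι ⊕ ι) ℂ}
    (h : Z * symplJ ι = symplJ ι * Z.map star) : symplJ ι * Z = Z.map star * symplJ ι := by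
  have h1 : symplJ ι * (Z * symplJ ι) * symplJ ι =
      symplJ ι * (symplJ ι * Z.map star) * symplJ ι := by
    rw [h]
  have h2 : symplJ ι * (Z * symplJ ι) * symplJ ι = -(symplJ ι * Z) := by
    rw [← Matrix.mul_assoc, Matrix.mul_assoc _ (symplJ ι), symplJ_mul_self, Matrix.mul_neg,
      Matrix.mul_one]
  rw [h2, ← Matrix.mul_assoc, symplJ_mul_self, Matrix.neg_mul, Matrix.neg_mul, Matrix.one_mul,
    neg_inj] at h1
  exact h1

/-- The orthogonal projection of all complex matrices onto `sp(N)`. -/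
def projSp (M : Matrix (ι ⊕ ι) (ι ⊕ ι) ℂ) : Matrix (ι ⊕ ι) (ι ⊕ ι) ℂ :=
  (1 / 4 : ℝ) • (M - Mᴴ - symplJ ι * M.map star * symplJ ι + symplJ ι * Mᵀ * symplJ ι)

/-- `projSp` averages over the group generated by the commuting involutions M ↦ -Mᴴ and M ↦ -J M̄ J,
and sp(N) is their common fixed space. -/
lemma projSp_mem (M : Matrix (ι ⊕ ι) (ι ⊕ ι) ℂ) : projSp M ∈ spAlgebra ι := by
  refine Submodule.smul_mem _ _ ((mem_spAlgebra_iff_symplJ _).2 ⟨?_, ?_⟩)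
  · have h1 : (M - Mᴴ - symplJ ι * M.map star * symplJ ι + symplJ ι * Mᵀ * symplJ ι).map star =
        M.map star - Mᵀ - symplJ ι * M * symplJ ι + symplJ ι * Mᴴ * symplJ ι := by
      have ha : ∀ a b : Matrix (ι ⊕ ι) (ι ⊕ ι) ℂ, (a + b).map star = a.map star + b.map star :=
        fun a b => by ext; simp
      have hb : ∀ a b : Matrix (ι ⊕ ι) (ι ⊕ ι) ℂ, (a - b).map star = a.map star - b.map star :=
        fun a b => by ext; simp
      have hc : Mᴴ.map star = Mᵀ := by ext; simp
      have hd : (M.map star).map star = M := by ext; simp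
      have he : Mᵀ.map star = Mᴴ := by ext; simp
      rw [ha, hb, hb, map_star_mul, map_star_mul, map_star_mul, map_star_mul, symplJ_map_star, hc,
        hd, he]
    rw [h1]
    have hJ := symplJ_mul_self (ι := ι)
    simp only [Matrix.add_mul, Matrix.sub_mul, Matrix.mul_add, Matrix.mul_sub, Matrix.mul_assoc, hJ]
    simp only [← Matrix.mul_assoc, hJ]
    simp only [Matrix.mul_neg, Matrix.neg_mul, Matrix.mul_one, Matrix.one_mul]
    abel
  · have hJ : (symplJ ι)ᴴ = -symplJ ι := by
      rw [← symplJ_transpose]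
      conv_rhs => rw [← symplJ_map_star]
      ext; simp
    have h1 : (M.map star)ᴴ = Mᵀ := by ext; simp
    have h2 : (Mᵀ)ᴴ = M.map star := by ext; simp
    simp only [Matrix.conjTranspose_add, Matrix.conjTranspose_sub, Matrix.conjTranspose_mul, hJ, h1,
      h2, Matrix.conjTranspose_conjTranspose, Matrix.mul_neg, Matrix.neg_mul, Matrix.mul_assoc]
    abel

/-- Since Z is fixed by both involutions, the four terms of the average pair with it to the same
real number; the sign comes from Zᴴ = -Z. -/
lemma traceInner_projSp (M : Matrix (ι ⊕ ι) (ι ⊕ ι) ℂ) {Z : Matrix (ι ⊕ ι) (ι ⊕ ι) ℂ}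
    (hZ : Z ∈ spAlgebra ι) : traceInner (projSp M) Z = -(M * Z).trace.re := by
  obtain ⟨h1, h2⟩ := (mem_spAlgebra_iff_symplJ Z).1 hZ
  have h3 := symplJ_mul_eq_map_star_mul h1
  have h4 : ∀ A : Matrix (ι ⊕ ι) (ι ⊕ ι) ℂ,
      (symplJ ι * A * symplJ ι * Z).trace = -(A * Z.map star).trace := fun A => by
    rw [Matrix.mul_assoc, h3, Matrix.mul_assoc, Matrix.trace_mul_comm]
    simp only [Matrix.mul_assoc, symplJ_mul_self]
    simp
  have h5 : (Mᴴ * Z).trace = -star (M * Z).trace := by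
    rw [← Matrix.trace_conjTranspose, Matrix.conjTranspose_mul, h2, Matrix.trace_mul_comm]
    simp
  have h6 : (M.map star * Z.map star).trace = star (M * Z).trace := by
    rw [← map_star_mul]
    simp only [Matrix.trace, Matrix.diag_apply, Matrix.map_apply, star_sum]
  have h7 : (Mᵀ * Z.map star).trace = -(M * Z).trace := by
    have : Z.map star = -Zᵀ := by
      rw [← Matrix.transpose_neg, ← h2]
      ext; simp
    rw [this, Matrix.mul_neg, Matrix.trace_neg, ← Matrix.transpose_mul, Matrix.trace_transpose,
      Matrix.trace_mul_comm]
  rw [projSp, traceInner_smul_left, traceInner, h2, Matrix.mul_neg, Matrix.add_mul, Matrix.sub_mul,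
    Matrix.sub_mul, Matrix.trace_neg, Matrix.trace_add, Matrix.trace_sub, Matrix.trace_sub, h4, h4,
    h5, h6, h7]
  simp
  ring

/-- `sp(N)` is unimodular. -/
lemma traceInner_lie_self {X Y : Matrix (ι ⊕ ι) (ι ⊕ ι) ℂ} (hY : Y ∈ spAlgebra ι) :
    traceInner ⁅X, Y⁆ Y = 0 := by
  rw [traceInner, ((mem_spAlgebra_iff Y).1 hY).2, Ring.lie_def, Matrix.mul_neg, Matrix.sub_mul,
    Matrix.trace_neg, Matrix.trace_sub, Matrix.trace_mul_comm (Y * X) Y, ← Matrix.mul_assoc,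
    Matrix.mul_assoc X, Matrix.trace_mul_comm X]
  simp

/-! ### Completeness relation and Casimir sums. -/

namespace IsOrthonormalBasis

variable {Z : Fin (dimSp ι) → Matrix (ι ⊕ ι) (ι ⊕ ι) ℂ} (hZ : IsOrthonormalBasis Z)
include hZ

/-- The completeness relation of an orthonormal basis of `sp(N)`. -/
lemma sum_trace_mul_smul (M : Matrix (ι ⊕ ι) (ι ⊕ ι) ℂ) :
    ∑ a, (M * Z a).trace • Z a = -(1 / 2 : ℂ) • (M + symplJ ι * Mᵀ * symplJ ι) := by
  have h1 : ∀ M, projSp M = ∑ a, -(M * Z a).trace.re • Z a := fun M => by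
    conv_lhs => rw [hZ.sum_smul _ (projSp_mem M)]
    exact Finset.sum_congr rfl fun a _ => by rw [traceInner_projSp M (hZ.mem a)]
  -- Replacing M by -iM turns Re tr(M Z) into Im tr(M Z), so this combination assembles the full
  -- complex trace. The antilinear terms of `projSp` cancel and the linear ones double.
  have h2 : projSp M + Complex.I • projSp (-Complex.I • M) =
      (1 / 2 : ℂ) • (M + symplJ ι * Mᵀ * symplJ ι) := by
    have e1 : (-Complex.I • M).map star = Complex.I • M.map star := by ext; simp
    have e2 : ∀ X : Matrix (ι ⊕ ι) (ι ⊕ ι) ℂ, (1 / 4 : ℝ) • X = (1 / 4 : ℂ) • X := fun X => by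
      ext; simp
    have e3 : Complex.I * Complex.I = -1 := Complex.I_mul_I
    have e4 : star (-Complex.I) = Complex.I := by simp
    simp only [projSp, e1, e2, Matrix.conjTranspose_smul, Matrix.transpose_smul, e4,
      Matrix.mul_smul, Matrix.smul_mul, smul_add, smul_sub, smul_smul]
    have e5 : Complex.I * (1 / 4 * -Complex.I) = 1 / 4 := by linear_combination (-1 / 4) * e3
    have e6 : Complex.I * (1 / 4 * Complex.I) = -(1 / 4) := by linear_combination (1 / 4) * e3
    rw [e5, e6]
    module
  rw [neg_smul, ← h2, h1, h1, Finset.smul_sum, ← Finset.sum_add_distrib, ← Finset.sum_neg_distrib]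
  refine Finset.sum_congr rfl fun a _ => ?_
  ext i j
  simp only [Matrix.smul_mul, Matrix.trace_smul, Matrix.neg_apply, Matrix.add_apply,
    Matrix.smul_apply, smul_eq_mul, Complex.real_smul]
  have := Complex.re_add_im (M * Z a).trace
  simp
  linear_combination (-(Z a i j)) * this

/-- The completeness relation for the matrix unit at (k, i), whose trace against `Z a` is the entry
(i, k). -/
lemma sum_apply_mul_apply (i k l j : ι ⊕ ι) :
    ∑ a, Z a i k * Z a l j = -(1 / 2 : ℂ) *
      ((1 : Matrix (ι ⊕ ι) (ι ⊕ ι) ℂ) l k * (1 : Matrix (ι ⊕ ι) (ι ⊕ ι) ℂ) i j +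
        symplJ ι l i * symplJ ι k j) := by
  have h := congrFun (congrFun (hZ.sum_trace_mul_smul (Matrix.single k i 1)) l) j
  have e2 : Matrix.single k i (1 : ℂ) l j =
      (1 : Matrix (ι ⊕ ι) (ι ⊕ ι) ℂ) l k * (1 : Matrix (ι ⊕ ι) (ι ⊕ ι) ℂ) i j := by
    rw [Matrix.single_apply, Matrix.one_apply, Matrix.one_apply]
    by_cases h1 : k = l <;> by_cases h2 : i = j <;> simp [h1, h2, Ne.symm]
  rw [Matrix.sum_apply, Matrix.smul_apply, Matrix.add_apply, Matrix.transpose_single, e2,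
    mul_single_mul_apply] at h
  rw [← smul_eq_mul, ← h]
  refine Finset.sum_congr rfl fun a _ => ?_
  simp [Matrix.trace_single_mul]

/-- Contract the entrywise relation with M. The minus sign appears because J_{li} must be rewritten
as -J_{il} to form a matrix product. -/
lemma sum_mul_mul (M : Matrix (ι ⊕ ι) (ι ⊕ ι) ℂ) :
    ∑ a, Z a * M * Z a = -(1 / 2 : ℂ) • (M.trace • 1 - symplJ ι * Mᵀ * symplJ ι) := by
  ext i j
  have h1 : ∀ a, (Z a * M * Z a) i j = ∑ l, ∑ k, M k l * (Z a i k * Z a l j) := fun a => by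
    rw [Matrix.mul_apply]
    refine Finset.sum_congr rfl fun l _ => ?_
    rw [Matrix.mul_apply, Finset.sum_mul]
    exact Finset.sum_congr rfl fun k _ => by ring
  have h2 : ∑ a, ∑ l, ∑ k, M k l * (Z a i k * Z a l j) =
      ∑ l, ∑ k, M k l * ∑ a, Z a i k * Z a l j := by
    rw [Finset.sum_comm]
    refine Finset.sum_congr rfl fun l _ => ?_
    rw [Finset.sum_comm]
    exact Finset.sum_congr rfl fun k _ => by rw [Finset.mul_sum]
  rw [Matrix.sum_apply]
  simp only [h1]
  rw [h2]
  simp only [hZ.sum_apply_mul_apply, symplJ_apply_comm i]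
  have h3 : ∀ l k, M k l * (-(1 / 2 : ℂ) * ((1 : Matrix (ι ⊕ ι) (ι ⊕ ι) ℂ) l k *
      (1 : Matrix (ι ⊕ ι) (ι ⊕ ι) ℂ) i j + -symplJ ι i l * symplJ ι k j)) =
      -(1 / 2 : ℂ) * ((M k l * (1 : Matrix (ι ⊕ ι) (ι ⊕ ι) ℂ) l k) *
        (1 : Matrix (ι ⊕ ι) (ι ⊕ ι) ℂ) i j - symplJ ι i l * M k l * symplJ ι k j) :=
    fun l k => by ring
  simp only [h3, ← Finset.mul_sum, Finset.sum_sub_distrib, ← Finset.sum_mul]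
  rw [Matrix.smul_apply, Matrix.sub_apply, Matrix.smul_apply, smul_eq_mul, smul_eq_mul]
  congr 2
  · congr 1
    simp [Matrix.one_apply, Matrix.trace]
  · simp only [Matrix.mul_apply, Finset.sum_mul, Matrix.transpose_apply]
    exact Finset.sum_comm

/-- The Casimir element of `sp(N)` acting on quaternionic Hermitian matrices. -/
lemma sum_lie_lie {F : Matrix (ι ⊕ ι) (ι ⊕ ι) ℂ} (hF : F * symplJ ι = symplJ ι * Fᵀ) :
    ∑ a, ⁅Z a, ⁅Z a, F⁆⁆ = -(2 * Fintype.card ι : ℂ) • F + F.trace • 1 := by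
  -- The case M = 1: the trace contributes 2N and -J² contributes 1.
  have h1 : ∑ a, Z a * Z a = -(1 / 2 : ℂ) • ((2 * Fintype.card ι + 1 : ℂ) • 1) := by
    have := hZ.sum_mul_mul 1
    simp only [Matrix.mul_one, Matrix.transpose_one, symplJ_mul_self, Matrix.trace_one] at this
    rw [this, add_smul, one_smul, sub_neg_eq_add]
    congr 3
    simp
    ring
  have h2 : ∑ a, Z a * F * Z a = -(1 / 2 : ℂ) • (F.trace • 1 + F) := by
    rw [hZ.sum_mul_mul, ← hF, Matrix.mul_assoc, symplJ_mul_self, Matrix.mul_neg, Matrix.mul_one,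
      sub_neg_eq_add]
  have h3 : ∀ a, ⁅Z a, ⁅Z a, F⁆⁆ = Z a * Z a * F - (2 : ℂ) • (Z a * F * Z a) + F * (Z a * Z a) := by
    intro a
    rw [Ring.lie_def, Ring.lie_def, two_smul]
    noncomm_ring
  -- The coefficient of F is -(2N+1) from the squares plus 1 from the mixed term.
  simp only [h3, Finset.sum_add_distrib, Finset.sum_sub_distrib, ← Finset.smul_sum,
    ← Matrix.sum_mul, ← Matrix.mul_sum, h1, h2]
  simp only [Matrix.smul_mul, Matrix.mul_smul, Matrix.one_mul, Matrix.mul_one]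
  module

/-- With E the matrix unit at (α, j), the entry [Z, F]_{jα} is tr([F, E] Z), so completeness
evaluates the sum of [Z_a, F]_{jα} [Z_a, F]. Using F² = 1 it equals D - F D F with D = E - J Eᵀ J,
and only F E F has a surviving (k, α) entry. -/
lemma sum_lie_apply_mul_lie_apply {F : Matrix (ι ⊕ ι) (ι ⊕ ι) ℂ}
    (hF : F * symplJ ι = symplJ ι * Fᵀ) (hF2 : F * F = 1) {j k α : ι ⊕ ι} (hj : j ≠ α) :
    ∑ a, ⁅Z a, F⁆ j α * ⁅Z a, F⁆ k α = -(F j α * F k α) := by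
  set E : Matrix (ι ⊕ ι) (ι ⊕ ι) ℂ := Matrix.single α j 1 with hE
  set E' := symplJ ι * Eᵀ * symplJ ι with hE'
  have hJJ := symplJ_mul_self (ι := ι)
  have hJF : Fᵀ * symplJ ι = symplJ ι * F := by
    have h := congrArg (fun A => symplJ ι * A * symplJ ι) hF
    simp only [Matrix.mul_assoc, hJJ, Matrix.mul_neg, Matrix.mul_one] at h
    rw [← Matrix.mul_assoc, ← Matrix.mul_assoc, hJJ, Matrix.neg_mul, Matrix.neg_mul,
      Matrix.one_mul, neg_inj] at h
    exact h.symm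
  have h1 : ∀ a, ⁅Z a, F⁆ j α = (⁅F, E⁆ * Z a).trace := by
    intro a
    rw [Ring.lie_def, Ring.lie_def, Matrix.sub_mul, Matrix.trace_sub, Matrix.mul_assoc,
      Matrix.trace_mul_comm, Matrix.mul_assoc, Matrix.mul_assoc]
    simp [hE, Matrix.trace_single_mul]
  have h2 : symplJ ι * ⁅F, E⁆ᵀ * symplJ ι = ⁅E', F⁆ := by
    rw [Ring.lie_def, Ring.lie_def, Matrix.transpose_sub, Matrix.transpose_mul,
      Matrix.transpose_mul, Matrix.mul_sub, Matrix.sub_mul, hE']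
    congr 1
    · rw [Matrix.mul_assoc, Matrix.mul_assoc, hJF]
      simp only [Matrix.mul_assoc]
    · rw [← Matrix.mul_assoc, ← hF]
      simp only [Matrix.mul_assoc]
  -- Completeness together with `h2` gives -½ [[F, E - E'], F]; F² = 1 then simplifies the double
  -- commutator.
  have h3 : ∑ a, ⁅Z a, F⁆ j α • ⁅Z a, F⁆ =
      (1 / 2 : ℂ) • ((E - E') + (E - E') - (2 : ℂ) • (F * E * F - F * E' * F)) := by
    have e1 : ∀ a, ⁅Z a, F⁆ j α • ⁅Z a, F⁆ = ⁅(⁅F, E⁆ * Z a).trace • Z a, F⁆ := fun a => by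
      rw [h1, Ring.lie_def (Z a), Ring.lie_def (_ • _), Matrix.smul_mul, Matrix.mul_smul, smul_sub]
    simp only [e1, Ring.lie_def (_ • _)]
    rw [Finset.sum_sub_distrib, ← Matrix.sum_mul, ← Matrix.mul_sum, hZ.sum_trace_mul_smul, h2]
    simp only [Ring.lie_def, Matrix.smul_mul, Matrix.mul_smul, Matrix.add_mul, Matrix.mul_add,
      Matrix.sub_mul, Matrix.mul_sub]
    have e2 : ∀ A : Matrix (ι ⊕ ι) (ι ⊕ ι) ℂ, F * (F * A) = A := fun A => by
      rw [← Matrix.mul_assoc, hF2, Matrix.one_mul]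
    simp only [Matrix.mul_assoc, hF2, e2, Matrix.mul_one]
    module
  have h4 : ∑ a, ⁅Z a, F⁆ j α * ⁅Z a, F⁆ k α = (∑ a, ⁅Z a, F⁆ j α • ⁅Z a, F⁆) k α := by
    rw [Matrix.sum_apply]
    rfl
  have hEk : E k α = 0 := by simp [hE, hj]
  -- This entry is J_{kj} J_{αα}, and an antisymmetric matrix has zero diagonal.
  have hE'k : E' k α = 0 := by
    have : symplJ ι α α = 0 := self_eq_neg.1 (symplJ_apply_comm α α)
    rw [hE', hE, Matrix.transpose_single, mul_single_mul_apply, this, mul_zero]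
  have hFE : (F * E * F) k α = F k α * F j α := mul_single_mul_apply _ _ _ _ _ _
  -- This entry is (F J)_{kj} (J F)_{αα}, and J F is antisymmetric too.
  have hFE' : (F * E' * F) k α = 0 := by
    have e1 : F * E' * F = (F * symplJ ι) * Matrix.single j α 1 * (symplJ ι * F) := by
      rw [hE', hE, Matrix.transpose_single]
      simp only [Matrix.mul_assoc]
    have e2 : (symplJ ι * F)ᵀ = -(symplJ ι * F) := by
      rw [Matrix.transpose_mul, symplJ_transpose, Matrix.mul_neg, hJF]
    have e3 : (symplJ ι * F) α α = 0 := self_eq_neg.1 (congrFun (congrFun e2 α) α)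
    rw [e1, mul_single_mul_apply, e3, mul_zero]
  rw [h4, h3]
  simp only [Matrix.smul_apply, Matrix.add_apply, Matrix.sub_apply, hEk, hE'k, hFE, hFE',
    smul_eq_mul]
  ring

end IsOrthonormalBasis


end Algebra

/-! ### Entrywise calculus of matrix-valued functions. -/

section MatrixDeriv

open Matrix Topology Filter

variable {d : ℕ} {κ : Type*} [Fintype κ]

/-- The partial derivative of a matrix valued function. -/
def matrixDeriv (i : Fin d) (A : (Fin d → ℝ) → Matrix κ κ ℂ) (x : Fin d → ℝ) : Matrix κ κ ℂ :=
  Matrix.of fun a b => partialDeriv i (fun y => A y a b) x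

/-- Differentiability of a matrix valued function. -/
def MatrixDifferentiableAt (A : (Fin d → ℝ) → Matrix κ κ ℂ) (x : Fin d → ℝ) : Prop :=
  ∀ a b, DifferentiableAt ℝ (fun y => A y a b) x

variable {A A' : (Fin d → ℝ) → Matrix κ κ ℂ} {x : Fin d → ℝ}

lemma matrixDeriv_const (i : Fin d) (M : Matrix κ κ ℂ) : matrixDeriv i (fun _ => M) x = 0 := by
  ext a b
  simp [matrixDeriv, partialDeriv]

lemma matrixDifferentiableAt_const (M : Matrix κ κ ℂ) : MatrixDifferentiableAt (fun _ => M) x :=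
  fun _ _ => differentiableAt_const _

lemma MatrixDifferentiableAt.mul (h : MatrixDifferentiableAt A x)
    (h' : MatrixDifferentiableAt A' x) : MatrixDifferentiableAt (fun y => A y * A' y) x := by
  intro a b
  simp only [Matrix.mul_apply]
  exact DifferentiableAt.fun_sum fun c _ => (h a c).fun_mul (h' c b)

lemma matrixDeriv_mul (i : Fin d) (h : MatrixDifferentiableAt A x)
    (h' : MatrixDifferentiableAt A' x) :
    matrixDeriv i (fun y => A y * A' y) x = matrixDeriv i A x * A' x + A x * matrixDeriv i A' x := by
  ext a b
  simp only [matrixDeriv, partialDeriv, Matrix.mul_apply, Matrix.add_apply, Matrix.of_apply]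
  rw [(HasFDerivAt.fun_sum fun c (_ : c ∈ Finset.univ) =>
    (h a c).hasFDerivAt.fun_mul (h' c b).hasFDerivAt).fderiv]
  simp only [_root_.sum_apply, _root_.add_apply, _root_.smul_apply, smul_eq_mul,
    Finset.sum_add_distrib]
  rw [add_comm]
  congr 1
  exact Finset.sum_congr rfl fun c _ => mul_comm _ _

lemma MatrixDifferentiableAt.sub (h : MatrixDifferentiableAt A x)
    (h' : MatrixDifferentiableAt A' x) : MatrixDifferentiableAt (fun y => A y - A' y) x :=
  fun a b => (h a b).fun_sub (h' a b)

lemma matrixDeriv_sub (i : Fin d) (h : MatrixDifferentiableAt A x)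
    (h' : MatrixDifferentiableAt A' x) :
    matrixDeriv i (fun y => A y - A' y) x = matrixDeriv i A x - matrixDeriv i A' x := by
  ext a b
  simp only [matrixDeriv, partialDeriv, Matrix.sub_apply, Matrix.of_apply]
  rw [fderiv_fun_sub (h a b) (h' a b)]
  rfl

lemma MatrixDifferentiableAt.const_lie (h : MatrixDifferentiableAt A x) (M : Matrix κ κ ℂ) :
    MatrixDifferentiableAt (fun y => ⁅M, A y⁆) x :=
  ((matrixDifferentiableAt_const M).mul h).sub (h.mul (matrixDifferentiableAt_const M))

lemma matrixDeriv_const_lie (i : Fin d) (h : MatrixDifferentiableAt A x) (M : Matrix κ κ ℂ) :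
    matrixDeriv i (fun y => ⁅M, A y⁆) x = ⁅M, matrixDeriv i A x⁆ := by
  simp only [Ring.lie_def]
  have hM := matrixDifferentiableAt_const (x := x) M
  rw [matrixDeriv_sub i (hM.mul h) (h.mul hM), matrixDeriv_mul i hM h, matrixDeriv_mul i h hM,
    matrixDeriv_const, Matrix.zero_mul, Matrix.mul_zero, zero_add, add_zero]

lemma MatrixDifferentiableAt.map_star (h : MatrixDifferentiableAt A x) :
    MatrixDifferentiableAt (fun y => (A y).map star) x :=
  fun a b => (h a b).star

/-- Differentiability need not be assumed: conjugation is an invertible real-linear map, so where an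
entry is not differentiable both sides take the default value 0. -/
lemma matrixDeriv_map_star (i : Fin d) :
    matrixDeriv i (fun y => (A y).map star) x = (matrixDeriv i A x).map star := by
  ext a b
  simp only [matrixDeriv, partialDeriv, Matrix.map_apply, Matrix.of_apply]
  rw [fderiv_star]
  rfl

lemma MatrixDifferentiableAt.conjTranspose (h : MatrixDifferentiableAt A x) :
    MatrixDifferentiableAt (fun y => (A y)ᴴ) x :=
  fun a b => (h b a).star

lemma matrixDeriv_conjTranspose (i : Fin d) :
    matrixDeriv i (fun y => (A y)ᴴ) x = (matrixDeriv i A x)ᴴ := by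
  ext a b
  simp only [matrixDeriv, partialDeriv, Matrix.conjTranspose_apply, Matrix.of_apply]
  rw [fderiv_star]
  rfl

lemma hasFDerivAt_traceInner (h : MatrixDifferentiableAt A x) (M : Matrix κ κ ℂ) :
    HasFDerivAt (fun y => traceInner (A y) M)
      (∑ a, ∑ b, Complex.reCLM ∘L (star (M a b) • fderiv ℝ (fun y => A y a b) x)) x := by
  simp only [traceInner_eq_sum]
  refine HasFDerivAt.fun_sum fun a _ => HasFDerivAt.fun_sum fun b _ => ?_
  exact Complex.reCLM.hasFDerivAt.comp x ((h a b).hasFDerivAt.mul_const (star (M a b)))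

lemma partialDeriv_traceInner (i : Fin d) (h : MatrixDifferentiableAt A x) (M : Matrix κ κ ℂ) :
    partialDeriv i (fun y => traceInner (A y) M) x = traceInner (matrixDeriv i A x) M := by
  unfold partialDeriv
  rw [(hasFDerivAt_traceInner h M).fderiv, traceInner_eq_sum]
  simp only [_root_.sum_apply]
  refine Finset.sum_congr rfl fun a _ => Finset.sum_congr rfl fun b _ => ?_
  simp only [ContinuousLinearMap.comp_apply, _root_.smul_apply, smul_eq_mul]
  rw [mul_comm]
  rfl

end MatrixDeriv

/-! ### The right-invariant frame in a smooth chart. -/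

section Chart

open Matrix Topology Filter

variable {ι : Type*} [Fintype ι] [DecidableEq ι] {e : Chart ι}

/-- The inverse of a chart as a matrix valued function. -/
abbrev chartMatrix (e : Chart ι) (y : Fin (dimSp ι) → ℝ) : Matrix (ι ⊕ ι) (ι ⊕ ι) ℂ :=
  toMatrix (e.symm y)

/-- The coordinate vector fields in the right trivialization of the tangent bundle. -/
def rightTriv (e : Chart ι) (i : Fin (dimSp ι)) (y : Fin (dimSp ι) → ℝ) :
    Matrix (ι ⊕ ι) (ι ⊕ ι) ℂ :=
  coordVector e i y * (chartMatrix e y)ᴴ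

lemma chartMatrix_mul_conjTranspose (e : Chart ι) (y : Fin (dimSp ι) → ℝ) :
    chartMatrix e y * (chartMatrix e y)ᴴ = 1 := toMatrix_mul_inv _

lemma conjTranspose_mul_chartMatrix (e : Chart ι) (y : Fin (dimSp ι) → ℝ) :
    (chartMatrix e y)ᴴ * chartMatrix e y = 1 := toMatrix_inv_mul _

lemma rightTriv_mul_chartMatrix (e : Chart ι) (i : Fin (dimSp ι)) (y : Fin (dimSp ι) → ℝ) :
    rightTriv e i y * chartMatrix e y = coordVector e i y := by
  rw [rightTriv, Matrix.mul_assoc, conjTranspose_mul_chartMatrix, Matrix.mul_one]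

/-- Cyclicity of the trace and unitarity of q turn left into right translation. The right
trivialization is preferred because it differentiates q M qᴴ to a commutator. -/
lemma metric_eq_traceInner (q : Sp ι) (A B : Matrix (ι ⊕ ι) (ι ⊕ ι) ℂ) :
    metric q A B = traceInner (A * (toMatrix q)ᴴ) (B * (toMatrix q)ᴴ) := by
  have h : (toMatrix q)ᴴ * toMatrix q = 1 := toMatrix_inv_mul q
  have h' : toMatrix q * (toMatrix q)ᴴ = 1 := toMatrix_mul_inv q
  rw [metric, traceInner, toMatrix_inv, Matrix.conjTranspose_mul, Matrix.conjTranspose_mul,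
    Matrix.conjTranspose_conjTranspose]
  have e1 : (toMatrix q)ᴴ * A * (Bᴴ * toMatrix q) = (toMatrix q)ᴴ * (A * Bᴴ * toMatrix q) := by
    simp only [Matrix.mul_assoc]
  have e2 : A * (toMatrix q)ᴴ * (toMatrix q * Bᴴ) = A * ((toMatrix q)ᴴ * toMatrix q) * Bᴴ := by
    simp only [Matrix.mul_assoc]
  rw [e1, e2, h, Matrix.trace_mul_comm, Matrix.mul_assoc, h', Matrix.mul_one, Matrix.mul_one]

/-- The coefficients of the coordinate vector fields in a right invariant frame. -/
def frameCoeff (e : Chart ι) (Z : Fin (dimSp ι) → Matrix (ι ⊕ ι) (ι ⊕ ι) ℂ)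
    (y : Fin (dimSp ι) → ℝ) : Matrix (Fin (dimSp ι)) (Fin (dimSp ι)) ℝ :=
  Matrix.of fun i a => traceInner (rightTriv e i y) (Z a)

namespace IsSmoothChart

variable (he : IsSmoothChart e) {y : Fin (dimSp ι) → ℝ} (hy : y ∈ e.target)
include he hy

lemma contDiffAt_param : ContDiffAt ℝ ∞ (param e) y :=
  he.contDiffOn.contDiffAt (e.open_target.mem_nhds hy)

lemma differentiableAt_chartMatrix : MatrixDifferentiableAt (chartMatrix e) y := fun a b =>
  differentiableAt_pi.1 (differentiableAt_pi.1
    ((he.contDiffAt_param hy).differentiableAt (by simp)) a) b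

lemma fderiv_param_apply (v : Fin (dimSp ι) → ℝ) (a b : ι ⊕ ι) :
    fderiv ℝ (fun z => chartMatrix e z a b) y v = fderiv ℝ (param e) y v a b := by
  have h := ((he.contDiffAt_param hy).differentiableAt (by simp)).hasFDerivAt
  have h1 := hasFDerivAt_pi'.1 (hasFDerivAt_pi'.1 h a) b
  exact congrArg (fun L => L v) h1.fderiv

lemma matrixDeriv_chartMatrix (i : Fin (dimSp ι)) :
    matrixDeriv i (chartMatrix e) y = coordVector e i y := by
  ext a b
  exact he.fderiv_param_apply hy _ a b

lemma contDiffAt_chartMatrix (a b : ι ⊕ ι) : ContDiffAt ℝ ∞ (fun z => chartMatrix e z a b) y :=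
  contDiffAt_pi.1 (contDiffAt_pi.1 (he.contDiffAt_param hy) a) b

lemma coordVector_eventuallyEq (i : Fin (dimSp ι)) (a b : ι ⊕ ι) :
    (fun z => coordVector e i z a b) =ᶠ[𝓝 y]
      fun z => fderiv ℝ (fun z => chartMatrix e z a b) z (Pi.single i 1) := by
  filter_upwards [e.open_target.mem_nhds hy] with z hz
  exact (he.fderiv_param_apply hz _ a b).symm

lemma differentiableAt_fderiv_chartMatrix (a b : ι ⊕ ι) :
    DifferentiableAt ℝ (fderiv ℝ fun z => chartMatrix e z a b) y :=
  ((he.contDiffAt_chartMatrix hy a b).fderiv_right (m := 1) (by norm_cast)).differentiableAt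
    (by simp)

lemma differentiableAt_coordVector (i : Fin (dimSp ι)) :
    MatrixDifferentiableAt (coordVector e i) y := fun a b =>
  ((he.differentiableAt_fderiv_chartMatrix hy a b).clm_apply
    (differentiableAt_const _)).congr_of_eventuallyEq (he.coordVector_eventuallyEq hy i a b)

/-- Both sides are entries of the second derivative of the inverse chart, which is symmetric. -/
lemma matrixDeriv_coordVector_comm (i j : Fin (dimSp ι)) :
    matrixDeriv j (coordVector e i) y = matrixDeriv i (coordVector e j) y := by
  have key : ∀ i j : Fin (dimSp ι), ∀ a b, partialDeriv j (fun z => coordVector e i z a b) y =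
      fderiv ℝ (fderiv ℝ fun z => chartMatrix e z a b) y (Pi.single j 1) (Pi.single i 1) := by
    intro i j a b
    unfold partialDeriv
    rw [(he.coordVector_eventuallyEq hy i a b).fderiv_eq,
      fderiv_clm_apply (he.differentiableAt_fderiv_chartMatrix hy a b) (differentiableAt_const _)]
    simp
  ext a b
  simp only [matrixDeriv, Matrix.of_apply, key]
  exact ((he.contDiffAt_chartMatrix hy a b).isSymmSndFDerivAt
    (by
      rw [minSmoothness_of_isRCLikeNormedField]
      exact WithTop.coe_le_coe.2 (le_top : (2 : ℕ∞) ≤ ⊤))).eq _ _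

/-- Differentiate the equations P J = J P̄ and P Pᴴ = 1 that the inverse chart P satisfies. -/
lemma rightTriv_mem (i : Fin (dimSp ι)) : rightTriv e i y ∈ spAlgebra ι := by
  have hP := he.differentiableAt_chartMatrix hy
  have hJ := matrixDifferentiableAt_const (x := y) (symplJ ι)
  rw [mem_spAlgebra_iff]
  constructor
  · refine isQuat_mul ((isQuat_iff _).2 ?_) (e.symm y)⁻¹.2
    have h1 : (fun z => chartMatrix e z * symplJ ι) =
        fun z => symplJ ι * (chartMatrix e z).map star :=
      funext fun z => (isQuat_iff _).1 (e.symm z).2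
    have h2 : matrixDeriv i (fun z => chartMatrix e z * symplJ ι) y =
        matrixDeriv i (fun z => symplJ ι * (chartMatrix e z).map star) y := by rw [h1]
    rw [matrixDeriv_mul i hP hJ, matrixDeriv_mul i hJ hP.map_star, matrixDeriv_const,
      matrixDeriv_map_star, Matrix.mul_zero, Matrix.zero_mul, add_zero, zero_add,
      he.matrixDeriv_chartMatrix hy] at h2
    exact h2
  · have h2 : matrixDeriv i (fun z => chartMatrix e z * (chartMatrix e z)ᴴ) y = 0 := by
      simp only [chartMatrix_mul_conjTranspose, matrixDeriv_const]
    rw [matrixDeriv_mul i hP hP.conjTranspose, matrixDeriv_conjTranspose,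
      he.matrixDeriv_chartMatrix hy] at h2
    rw [rightTriv, Matrix.conjTranspose_mul, Matrix.conjTranspose_conjTranspose]
    exact eq_neg_of_add_eq_zero_right h2

/-- With ∂P = Y P and Yᴴ = -Y, the product rule puts Y on the left and -Y on the right. -/
lemma matrixDeriv_conj (i : Fin (dimSp ι)) (M : Matrix (ι ⊕ ι) (ι ⊕ ι) ℂ) :
    matrixDeriv i (fun z => chartMatrix e z * M * (chartMatrix e z)ᴴ) y =
      ⁅rightTriv e i y, chartMatrix e y * M * (chartMatrix e y)ᴴ⁆ := by
  have hP := he.differentiableAt_chartMatrix hy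
  have hM := matrixDifferentiableAt_const (x := y) M
  have hY := ((mem_spAlgebra_iff _).1 (he.rightTriv_mem hy i)).2
  rw [matrixDeriv_mul i (hP.mul hM) hP.conjTranspose, matrixDeriv_mul i hP hM, matrixDeriv_const,
    matrixDeriv_conjTranspose, he.matrixDeriv_chartMatrix hy, Matrix.mul_zero, add_zero,
    ← rightTriv_mul_chartMatrix, Matrix.conjTranspose_mul, hY, Ring.lie_def]
  simp only [Matrix.mul_assoc, Matrix.mul_neg, sub_eq_add_neg]

lemma differentiableAt_conj (M : Matrix (ι ⊕ ι) (ι ⊕ ι) ℂ) :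
    MatrixDifferentiableAt (fun z => chartMatrix e z * M * (chartMatrix e z)ᴴ) y :=
  ((he.differentiableAt_chartMatrix hy).mul (matrixDifferentiableAt_const M)).mul
    (he.differentiableAt_chartMatrix hy).conjTranspose

lemma differentiableAt_rightTriv (i : Fin (dimSp ι)) : MatrixDifferentiableAt (rightTriv e i) y :=
  (he.differentiableAt_coordVector hy i).mul (he.differentiableAt_chartMatrix hy).conjTranspose

/-- The Maurer-Cartan equation. -/
lemma matrixDeriv_rightTriv_sub (i j : Fin (dimSp ι)) :
    matrixDeriv j (rightTriv e i) y - matrixDeriv i (rightTriv e j) y =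
      ⁅rightTriv e j y, rightTriv e i y⁆ := by
  -- The derivative of Pᴴ is -Pᴴ Y_j. The second derivatives of P are symmetric and cancel in the
  -- difference.
  have key : ∀ i j, matrixDeriv j (rightTriv e i) y =
      matrixDeriv j (coordVector e i) y * (chartMatrix e y)ᴴ -
        rightTriv e i y * rightTriv e j y := by
    intro i j
    have hY := ((mem_spAlgebra_iff _).1 (he.rightTriv_mem hy j)).2
    have h1 : matrixDeriv j (rightTriv e i) y =
        matrixDeriv j (fun z => coordVector e i z * (chartMatrix e z)ᴴ) y := rfl
    rw [h1, matrixDeriv_mul j (he.differentiableAt_coordVector hy i)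
      (he.differentiableAt_chartMatrix hy).conjTranspose, matrixDeriv_conjTranspose,
      he.matrixDeriv_chartMatrix hy, ← rightTriv_mul_chartMatrix e j, Matrix.conjTranspose_mul, hY,
      ← Matrix.mul_assoc, Matrix.mul_neg, sub_eq_add_neg]
    rfl
  rw [key i j, key j i, he.matrixDeriv_coordVector_comm hy, Ring.lie_def]
  abel

variable {Z : Fin (dimSp ι) → Matrix (ι ⊕ ι) (ι ⊕ ι) ℂ} (hZ : IsOrthonormalBasis Z)
include hZ

lemma rightTriv_eq_sum (i : Fin (dimSp ι)) :
    rightTriv e i y = ∑ a, frameCoeff e Z y i a • Z a :=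
  hZ.sum_smul _ (he.rightTriv_mem hy i)

lemma gram_eq : gram e y = frameCoeff e Z y * (frameCoeff e Z y)ᵀ := by
  ext i j
  rw [gram, Matrix.of_apply, metric_eq_traceInner, Matrix.mul_apply]
  change traceInner (rightTriv e i y) (rightTriv e j y) = _
  rw [traceInner_comm]
  conv_lhs => rw [he.rightTriv_eq_sum hy hZ j, traceInner_sum_smul_left]
  refine Finset.sum_congr rfl fun a _ => ?_
  rw [traceInner_comm, mul_comm]
  rfl

/-- A vector v with v B = 0 satisfies ∑ v_i Y_i = 0, hence ∑ v_i ∂_i P = 0, and v vanishes because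
the inverse chart is an immersion. -/
lemma det_frameCoeff_ne_zero : (frameCoeff e Z y).det ≠ 0 := by
  intro h
  obtain ⟨v, hv, hv0⟩ := Matrix.exists_vecMul_eq_zero_iff.2 h
  apply hv
  apply he.injective_fderiv y hy
  rw [map_zero]
  have h1 : ∑ i, v i • rightTriv e i y = 0 := by
    simp only [he.rightTriv_eq_sum hy hZ, Finset.smul_sum, smul_smul]
    rw [Finset.sum_comm]
    refine Finset.sum_eq_zero fun a _ => ?_
    rw [← Finset.sum_smul]
    have : ∑ i, v i * frameCoeff e Z y i a = 0 := congrFun hv0 a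
    rw [this, zero_smul]
  have h2 : ∑ i, v i • coordVector e i y = 0 := by
    simp only [← rightTriv_mul_chartMatrix, ← Matrix.smul_mul]
    rw [← Matrix.sum_mul, h1, Matrix.zero_mul]
  have h3 : v = ∑ i, v i • Pi.single i (1 : ℝ) := by
    ext i
    simp [Finset.sum_apply, Pi.single_apply]
  rw [h3, map_sum]
  ext a b
  have h4 := congrFun (congrFun h2 a) b
  rw [Matrix.sum_apply] at h4
  rw [Finset.sum_apply, Finset.sum_apply]
  simp only [map_smul]
  exact h4

lemma differentiableAt_frameCoeff (i a : Fin (dimSp ι)) :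
    DifferentiableAt ℝ (fun z => frameCoeff e Z z i a) y :=
  (hasFDerivAt_traceInner (he.differentiableAt_rightTriv hy i) (Z a)).differentiableAt

lemma sum_inv_frameCoeff_smul (c : Fin (dimSp ι)) :
    ∑ i, (frameCoeff e Z y)⁻¹ c i • rightTriv e i y = Z c := by
  simp only [he.rightTriv_eq_sum hy hZ]
  exact sum_inv_smul_sum_smul (he.det_frameCoeff_ne_zero hy hZ) Z c

/-- This is the hypothesis of `sum_partialDeriv_abs_det_mul_inv`. By Maurer-Cartan the sum equals
∑_c ⟨[Z_a, Z_c], Z_c⟩, and every term is zero by `traceInner_lie_self`. -/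
lemma sum_structure_eq_zero (a : Fin (dimSp ι)) :
    ∑ i, ∑ j, ∑ c, (frameCoeff e Z y)⁻¹ a j * (frameCoeff e Z y)⁻¹ c i *
      (partialDeriv j (fun z => frameCoeff e Z z i c) y -
        partialDeriv i (fun z => frameCoeff e Z z j c) y) = 0 := by
  set C := (frameCoeff e Z y)⁻¹ with hC
  have hsub : ∀ X Y W : Matrix (ι ⊕ ι) (ι ⊕ ι) ℂ,
      traceInner X W - traceInner Y W = traceInner (X - Y) W := fun X Y W => by
    simp [traceInner, Matrix.sub_mul]
  have h1 : ∀ i j c, partialDeriv j (fun z => frameCoeff e Z z i c) y -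
      partialDeriv i (fun z => frameCoeff e Z z j c) y =
      traceInner ⁅rightTriv e j y, rightTriv e i y⁆ (Z c) := by
    intro i j c
    rw [← he.matrixDeriv_rightTriv_sub hy, ← hsub,
      ← partialDeriv_traceInner _ (he.differentiableAt_rightTriv hy _),
      ← partialDeriv_traceInner _ (he.differentiableAt_rightTriv hy _)]
    rfl
  have h2 : ∀ c, traceInner ⁅Z a, Z c⁆ (Z c) =
      ∑ i, ∑ j, C a j * C c i * traceInner ⁅rightTriv e j y, rightTriv e i y⁆ (Z c) := by
    intro c
    have e1 : ⁅Z a, Z c⁆ = ∑ i, ∑ j, (C a j * C c i) • ⁅rightTriv e j y, rightTriv e i y⁆ := by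
      conv_lhs => rw [← he.sum_inv_frameCoeff_smul hy hZ a, ← he.sum_inv_frameCoeff_smul hy hZ c]
      rw [Ring.lie_def, Finset.sum_mul_sum, Finset.sum_mul_sum, Finset.sum_comm,
        ← Finset.sum_sub_distrib]
      refine Finset.sum_congr rfl fun i _ => ?_
      rw [← Finset.sum_sub_distrib]
      refine Finset.sum_congr rfl fun j _ => ?_
      rw [smul_mul_smul_comm, smul_mul_smul_comm, mul_comm (C c i), ← smul_sub, ← Ring.lie_def]
    rw [e1]
    simp only [traceInner, Matrix.sum_mul, Matrix.trace_sum, Matrix.smul_mul, Matrix.trace_smul,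
      Complex.re_sum, Complex.smul_re, smul_eq_mul]
  have h3 : ∑ c, traceInner ⁅Z a, Z c⁆ (Z c) = 0 :=
    Finset.sum_eq_zero fun c _ => traceInner_lie_self (hZ.mem c)
  simp only [h2] at h3
  rw [Finset.sum_comm] at h3
  simp only [h1]
  rw [← h3]
  exact Finset.sum_congr rfl fun i _ => Finset.sum_comm

end IsSmoothChart

end Chart

/-! ### The functions ψ̂ and the two identities. -/

section PsiHat

open Matrix Topology Filter

variable {m n : ℕ} {e : Chart (Fin m ⊕ Fin n)}

/-- The matrix `q Î_{m,n} q̄ᵗ`. -/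
def conjHatI (q : Sp (Fin m ⊕ Fin n)) :
    Matrix ((Fin m ⊕ Fin n) ⊕ (Fin m ⊕ Fin n)) ((Fin m ⊕ Fin n) ⊕ (Fin m ⊕ Fin n)) ℂ :=
  toMatrix q * hatI m n * (toMatrix q)ᴴ

lemma conjHatI_mul_self (q : Sp (Fin m ⊕ Fin n)) : conjHatI q * conjHatI q = 1 := by
  have h : (toMatrix q)ᴴ * toMatrix q = 1 := toMatrix_inv_mul q
  have h' : toMatrix q * (toMatrix q)ᴴ = 1 := toMatrix_mul_inv q
  have hI : hatI m n * hatI m n = 1 := by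
    simp [hatI, signMatrix, Matrix.fromBlocks_multiply, Matrix.fromBlocks_one]
  calc conjHatI q * conjHatI q =
      toMatrix q * (hatI m n * ((toMatrix q)ᴴ * toMatrix q) * hatI m n) * (toMatrix q)ᴴ := by
        simp only [conjHatI, Matrix.mul_assoc]
    _ = 1 := by rw [h, Matrix.mul_one, hI, Matrix.mul_one, h']

/-- F = q Î qᴴ is quaternionic, so F J = J F̄, and Hermitian, so F̄ = Fᵀ. -/
lemma conjHatI_mul_symplJ (q : Sp (Fin m ⊕ Fin n)) :
    conjHatI q * symplJ _ = symplJ _ * (conjHatI q)ᵀ := by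
  have hs : (signMatrix m n).map star = signMatrix m n := by
    ext i j
    rcases i with i | i <;> rcases j with j | j <;>
      simp [signMatrix, Matrix.one_apply, apply_ite]
  have hI : ∃ z w, hatI m n = quatMatrix z w := by
    refine ⟨signMatrix m n, 0, ?_⟩
    rw [hatI, quatMatrix, hs]
    congr 1
    ext; simp
  have hq : ∃ z w, conjHatI q = quatMatrix z w := isQuat_mul (isQuat_mul q.2 hI) q⁻¹.2
  have hH : (hatI m n)ᴴ = hatI m n := by
    simp [hatI, signMatrix, Matrix.fromBlocks_conjTranspose]
  have hF : (conjHatI q)ᴴ = conjHatI q := by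
    rw [conjHatI, Matrix.conjTranspose_mul, Matrix.conjTranspose_mul,
      Matrix.conjTranspose_conjTranspose, hH, Matrix.mul_assoc]
  have hT : (conjHatI q)ᵀ = (conjHatI q).map star := by
    conv_lhs => rw [← hF]
    ext; simp
  rw [hT]
  exact (isQuat_iff _).1 hq

lemma psiHat_eq {j α : (Fin m ⊕ Fin n) ⊕ (Fin m ⊕ Fin n)} (hj : j ≠ α) (q : Sp (Fin m ⊕ Fin n)) :
    psiHat m n j α q = 1 / 2 * conjHatI q j α := by
  simp [psiHat, conjHatI, hj]

lemma partialDeriv_const_mul {d : ℕ} (i : Fin d) (c : ℂ) {f : (Fin d → ℝ) → ℂ} {x : Fin d → ℝ}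
    (h : DifferentiableAt ℝ f x) :
    partialDeriv i (fun y => c * f y) x = c * partialDeriv i f x := by
  unfold partialDeriv
  rw [fderiv_const_mul h]
  rfl

variable {Z : Fin (dimSp (Fin m ⊕ Fin n)) → _} (hZ : IsOrthonormalBasis Z)
  (he : IsSmoothChart e) {j α : (Fin m ⊕ Fin n) ⊕ (Fin m ⊕ Fin n)}

include he in
lemma differentiableAt_conjHatI {y : Fin (dimSp (Fin m ⊕ Fin n)) → ℝ} (hy : y ∈ e.target) :
    MatrixDifferentiableAt (fun z => conjHatI (e.symm z)) y :=
  he.differentiableAt_conj hy (hatI m n)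

include he in
lemma matrixDeriv_conjHatI {y : Fin (dimSp (Fin m ⊕ Fin n)) → ℝ} (hy : y ∈ e.target)
    (i : Fin (dimSp (Fin m ⊕ Fin n))) :
    matrixDeriv i (fun z => conjHatI (e.symm z)) y = ⁅rightTriv e i y, conjHatI (e.symm y)⁆ :=
  he.matrixDeriv_conj hy i (hatI m n)

lemma sum_smul_lie_apply {d : ℕ} {κ : Type*} [Fintype κ] [DecidableEq κ] (c : Fin d → ℝ)
    (X : Fin d → Matrix κ κ ℂ) (M : Matrix κ κ ℂ) (j α : κ) :
    ⁅∑ a, c a • X a, M⁆ j α = ∑ a, c a • ⁅X a, M⁆ j α := by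
  simp only [Ring.lie_def, Matrix.sum_mul, Matrix.mul_sum, Matrix.sub_apply, Matrix.sum_apply,
    Matrix.smul_mul, Matrix.mul_smul, Matrix.smul_apply, ← Finset.sum_sub_distrib, smul_sub]

include hZ he in
-- Identifies the frame derivatives of ψ̂ as ½ [Z_a, F]_{jα}, in the shape that the frame formulas
-- for τ and κ require.
lemma partialDeriv_psiHat (hj : j ≠ α) {y : Fin (dimSp (Fin m ⊕ Fin n)) → ℝ} (hy : y ∈ e.target)
    (i : Fin (dimSp (Fin m ⊕ Fin n))) :
    partialDeriv i (psiHat m n j α ∘ e.symm) y =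
      ∑ a, frameCoeff e Z y i a • (1 / 2 * ⁅Z a, conjHatI (e.symm y)⁆ j α) := by
  have h1 : psiHat m n j α ∘ e.symm = fun z => 1 / 2 * conjHatI (e.symm z) j α :=
    funext fun z => psiHat_eq hj _
  have h2 : partialDeriv i (fun z => conjHatI (e.symm z) j α) y =
      ⁅rightTriv e i y, conjHatI (e.symm y)⁆ j α :=
    congrFun (congrFun (matrixDeriv_conjHatI he hy i) j) α
  rw [h1, partialDeriv_const_mul i _ (differentiableAt_conjHatI he hy j α), h2,
    he.rightTriv_eq_sum hy hZ, sum_smul_lie_apply, Finset.mul_sum]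
  exact Finset.sum_congr rfl fun a _ => by rw [mul_smul_comm]

include he in
lemma tension_psiHat (hj : j ≠ α) {q : Sp (Fin m ⊕ Fin n)} (hq : q ∈ e.source) :
    tension e (psiHat m n j α) q = -2 * ((m : ℂ) + (n : ℂ)) * psiHat m n j α q := by
  obtain ⟨Z, hZ⟩ := exists_isOrthonormalBasis (Fin m ⊕ Fin n)
  have hx := e.map_source hq
  have hF := fun y hy => differentiableAt_conjHatI he (y := y) hy
  have hnear : ∀ᶠ y in 𝓝 (e q), y ∈ e.target := e.open_target.mem_nhds hx
  have h0 := he.det_frameCoeff_ne_zero hx hZ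
  have hf : ∀ a, DifferentiableAt ℝ (fun y => 1 / 2 * ⁅Z a, conjHatI (e.symm y)⁆ j α) (e q) :=
    fun a => ((hF _ hx).const_lie (Z a) j α).const_mul _
  have key := laplacian_eq_sum_frame (g := gram e) (φ := psiHat m n j α ∘ e.symm)
    (fun i a => he.differentiableAt_frameCoeff hx hZ i a) h0
    (fun a => sum_partialDeriv_abs_det_mul_inv (he.differentiableAt_frameCoeff hx hZ) h0 a
      (he.sum_structure_eq_zero hx hZ a)) hf
    (hnear.mono fun y hy => he.gram_eq hy hZ)
    (hnear.mono fun y hy i => partialDeriv_psiHat hZ he hj hy i)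
  have h1 : ∀ a k, partialDeriv k (fun y => 1 / 2 * ⁅Z a, conjHatI (e.symm y)⁆ j α) (e q) =
      1 / 2 * ⁅Z a, ⁅rightTriv e k (e q), conjHatI q⁆⁆ j α := by
    intro a k
    rw [partialDeriv_const_mul k _ ((hF _ hx).const_lie (Z a) j α)]
    have h2 := congrFun (congrFun (matrixDeriv_const_lie k (hF _ hx) (Z a)) j) α
    rw [matrixDeriv_conjHatI he hx, e.left_inv hq] at h2
    rw [← h2]
    rfl
  -- B⁻¹ recombines the coordinate fields into `Z a`, so the second frame derivative is a double
  -- commutator.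
  have h3 : ∀ a, ∑ k, (frameCoeff e Z (e q))⁻¹ a k •
      (1 / 2 * ⁅Z a, ⁅rightTriv e k (e q), conjHatI q⁆⁆ j α) =
      1 / 2 * ⁅Z a, ⁅Z a, conjHatI q⁆⁆ j α := by
    intro a
    have e1 : ⁅Z a, ⁅Z a, conjHatI q⁆⁆ = ∑ k, (frameCoeff e Z (e q))⁻¹ a k •
        ⁅Z a, ⁅rightTriv e k (e q), conjHatI q⁆⁆ := by
      have e0 : ⁅Z a, conjHatI q⁆ = ∑ k, (frameCoeff e Z (e q))⁻¹ a k •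
          ⁅rightTriv e k (e q), conjHatI q⁆ := by
        conv_lhs => rw [← he.sum_inv_frameCoeff_smul hx hZ a]
        simp only [Ring.lie_def, Matrix.sum_mul, Matrix.mul_sum, Matrix.smul_mul, Matrix.mul_smul,
          ← Finset.sum_sub_distrib, smul_sub]
      conv_lhs => rw [e0]
      simp only [Ring.lie_def (Z a), Matrix.sum_mul, Matrix.mul_sum, Matrix.smul_mul,
        Matrix.mul_smul, ← Finset.sum_sub_distrib, smul_sub]
    rw [e1, Matrix.sum_apply, Finset.mul_sum]
    exact Finset.sum_congr rfl fun k _ => by rw [Matrix.smul_apply, mul_smul_comm]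
  rw [tension, key]
  simp only [h1, h3]
  -- The term tr(F) 1 of the Casimir sum drops out because j ≠ α.
  rw [← Finset.mul_sum, ← Matrix.sum_apply, hZ.sum_lie_lie (conjHatI_mul_symplJ q), psiHat_eq hj]
  simp [hj]
  ring

include he in
lemma conformality_psiHat {k : (Fin m ⊕ Fin n) ⊕ (Fin m ⊕ Fin n)} (hj : j ≠ α) (hk : k ≠ α)
    {q : Sp (Fin m ⊕ Fin n)} (hq : q ∈ e.source) :
    conformality e (psiHat m n j α) (psiHat m n k α) q =
      -(psiHat m n j α q * psiHat m n k α q) := by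
  obtain ⟨Z, hZ⟩ := exists_isOrthonormalBasis (Fin m ⊕ Fin n)
  have hx := e.map_source hq
  rw [conformality, he.gram_eq hx hZ]
  simp only [partialDeriv_psiHat hZ he hj hx, partialDeriv_psiHat hZ he hk hx, e.left_inv hq]
  rw [sum_inv_gram_smul (he.det_frameCoeff_ne_zero hx hZ), psiHat_eq hj, psiHat_eq hk]
  have h1 := hZ.sum_lie_apply_mul_lie_apply (conjHatI_mul_symplJ q) (conjHatI_mul_self q)
    (k := k) hj
  simp only [mul_mul_mul_comm (1 / 2 : ℂ)]
  rw [← Finset.mul_sum, h1]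
  ring

end PsiHat

end QuaternionicUnitary

end

-- By `exists_isSmoothChart` every point lies in the source of a smooth chart, so the identities in
-- all charts hold on the whole group.
open QuaternionicUnitary in
theorem mainTheorem3 (m n : ℕ) (hm : 0 < m) (hn : 0 < n)
    (j k α : (Fin m ⊕ Fin n) ⊕ (Fin m ⊕ Fin n)) (hj : j ≠ α) (hk : k ≠ α)
    (e : Chart (Fin m ⊕ Fin n)) (he : IsSmoothChart e)
    (q : Sp (Fin m ⊕ Fin n)) (hq : q ∈ e.source) :
    tension e (psiHat m n j α) q = -2 * ((m : ℂ) + (n : ℂ)) * psiHat m n j α q ∧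
      conformality e (psiHat m n j α) (psiHat m n k α) q =
        -(psiHat m n j α q * psiHat m n k α q) :=
  ⟨tension_psiHat he hj hq, conformality_psiHat he hj hk hq⟩
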